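/- There is a universal constant $C>0$ and, for every dimension $d\ge 1$ and all parameters $\varepsilon,\eta>0$, a randomized adaptive tomography algorithm with the following properties. Its only quantum memory is a single $d$-dimensional register, initialized in a fixed basis state (in particular, only $n$ qubits when $d=2^n$); its steps are to apply to this register a unitary of its own choice, to apply to this register the unknown unitary $Z\in U(d)$, or to measure the register in the computational basis, and every choice may depend on the earlier measurement outcomes and on classical randomness drawn independently of $Z$. In every run it applies $Z$ at most $$C\cdot\frac{d^2}{\varepsilon^2}\cdot\log\max\{2,1/\eta\}$$ times (thus $O(d^2/\varepsilon^2)\cdot\log(1/\eta)$ times when $\eta\le\frac12$). For every $Z\in U(d)$ it outputs a classical description of a random unitary $\boldsymbol V\in U(d)$ satisfying $$\Pr\Bigl[\,\min_{\phi\in\mathbb C,\ |\phi|=1}\ \|\phi Z-\boldsymbol V\|_{\mathrm{op}}>\varepsilon\Bigr]\le\eta,$$ where $\|\cdot\|_{\mathrm{op}}$ is the largest singular value. -/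

import Mathlib

open MeasureTheory

noncomputable section

namespace UnitaryTomography

/-- The group `U(d)` of `d × d` unitary matrices. -/
abbrev UU (d : ℕ) : Type := Matrix.unitaryGroup (Fin d) ℂ

/-- `U(d)` carries its Borel σ-algebra. -/
instance instMeasurableSpaceUU (d : ℕ) : MeasurableSpace (UU d) := borel (UU d)

instance instBorelSpaceUU (d : ℕ) : BorelSpace (UU d) := ⟨rfl⟩

/-- The operator (spectral) norm of a matrix: the norm of the operator it induces on `ℂ^d` with its
Euclidean norm. -/
def opNorm {d : ℕ} (A : Matrix (Fin d) (Fin d) ℂ) : ℝ :=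
  ‖Matrix.toEuclideanCLM (𝕜 := ℂ) A‖

/-- Operator-norm distance up to a global phase. The infimum over the unit circle is a minimum,
since the circle is compact. -/
def phaseDist {d : ℕ} (U V : UU d) : ℝ :=
  ⨅ φ : Circle, opNorm ((φ : ℂ) • (U : Matrix (Fin d) (Fin d) ℂ) - (V : Matrix (Fin d) (Fin d) ℂ))

/-- An adaptive algorithm (with its classical random seed already fixed) whose only quantum memory
is a single `d`-dimensional register, and whose only access to the unknown unitary is to apply it
to that register. It is a finite tree; at each node the algorithm
* halts and outputs (the classical description of) a unitary, or
* applies a unitary of its own choice to the register, or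
* applies the unknown unitary to the register, or
* measures the register in the computational basis and continues depending on the outcome.
A measurement in another basis is a unitary followed by `measure`; the register is reset to a fixed
state by `measure` followed by a unitary that depends on the outcome. -/
inductive Protocol (d : ℕ) : Type
  | output (V : UU d) : Protocol d
  | applyUnitary (U : UU d) (next : Protocol d) : Protocol d
  | query (next : Protocol d) : Protocol d
  | measure (next : Fin d → Protocol d) : Protocol d

namespace Protocol

variable {d : ℕ}

/-- The largest number of applications of the unknown unitary over all sequences of measurement
outcomes. -/
def queries : Protocol d → ℕ
  | output _ => 0
  | applyUnitary _ next => next.queries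
  | query next => next.queries + 1
  | measure next => Finset.univ.sup fun i => (next i).queries

/-- The law of the output when the unknown unitary is `Z` and the register is in the pure state `ψ`.
By the Born rule, a measurement has outcome `i` with probability `|ψ i|²`, and leaves the register
in the basis state `i` (up to an unobservable global phase). -/
def law (Z : UU d) : Protocol d → (Fin d → ℂ) → Measure (UU d)
  | output V, _ => Measure.dirac V
  | applyUnitary U next, ψ => law Z next ((U : Matrix (Fin d) (Fin d) ℂ).mulVec ψ)
  | query next, ψ => law Z next ((Z : Matrix (Fin d) (Fin d) ℂ).mulVec ψ)
  | measure next, ψ => ∑ i, ENNReal.ofReal (‖ψ i‖ ^ 2) • law Z (next i) (Pi.single i 1)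

end Protocol

/-- A tomography algorithm on a single `d`-dimensional register: it draws a classical random seed,
independently of the unknown unitary, and then runs the protocol selected by the seed, starting
with the register in the basis state `0`. Measurability of the output law in the seed says that the
output is a random variable. -/
structure TomographyAlgorithm (d : ℕ) [NeZero d] where
  Seed : Type
  [measurableSpace : MeasurableSpace Seed]
  seedLaw : Measure Seed
  [isProbabilityMeasure : IsProbabilityMeasure seedLaw]
  protocol : Seed → Protocol d
  measurable_law : ∀ Z : UU d, Measurable fun s => (protocol s).law Z (Pi.single 0 1)

namespace TomographyAlgorithm

variable {d : ℕ} [NeZero d]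

/-- The law of the output of the algorithm when the unknown unitary is `Z`. -/
def outputLaw (A : TomographyAlgorithm d) (Z : UU d) : Measure (UU d) :=
  letI := A.measurableSpace
  A.seedLaw.bind fun s => (A.protocol s).law Z (Pi.single 0 1)

/-- In every run the algorithm applies the unknown unitary at most `Q` times. -/
def QueriesAtMost (A : TomographyAlgorithm d) (Q : ℝ) : Prop :=
  ∀ s : A.Seed, ((A.protocol s).queries : ℝ) ≤ Q

end TomographyAlgorithm

end UnitaryTomography

end

/-!
Measure a state `v` in the computational basis or in the Fourier basis with random fourth roots of
unity as phases. A rescaled, recentred projection onto the observed basis vector has mean `v v†`,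
and its deviation from the mean, tested against two unit vectors, has an exponential moment that is
bounded independently of `d`: an unnormalized sum with random fourth-root phases has the
exponential square moments of a Gaussian vector. Hence a net of size `exp (O(d))` shows that the
mean of `O(d / δ²)` trials is within `δ` of `v v†` in operator norm, outside an event of
exponentially small probability.

Apply this to `Z e₀`, and to the images of the probe states `p_j = (e₀ + e_j) / √2`, `p₀ = e₀`.
If `P_j` is the projection onto `Z p_j`, then `2 P_j - 1` maps `Z e₀` to `Z e_j`; the phase lost in
the state found for `Z e₀` is thus common to all columns. For a fixed such state the errors of the
`d` columns are independent, so their exponential moments multiply, and the same net argument bounds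
the operator norm of the whole error matrix with only `O(d / ε²)` trials per column. Rounding to the
nearest unitary at most doubles the error.
-/

noncomputable section

namespace UnitaryTomography

section ExponentialMoments

lemma exp_mul_le_one_add_mul_add {a c : ℝ} (hc : 0 < c) (ha : 0 ≤ a) (hac : a ≤ c / 2) (t : ℝ) :
    Real.exp (a * t) ≤ 1 + a * t + 8 / c ^ 2 * a ^ 2 * Real.exp (c * |t|) := by
  have taylor : Real.exp (a * t) ≤ 1 + a * t + |a * t| ^ 2 * Real.exp |a * t| := by
    have h := Complex.norm_exp_sub_sum_le_norm_mul_exp ((a * t : ℝ) : ℂ) 2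
    simp only [Finset.sum_range_succ, Finset.sum_range_zero, pow_zero, pow_one, Nat.factorial_zero,
      Nat.factorial_one, Nat.cast_one, div_one, zero_add] at h
    norm_cast at h
    rw [Real.norm_eq_abs (a * t)] at h
    linarith [Real.le_norm_self (Real.exp (a * t) - (1 + a * t))]
  have quadratic : |a * t| ^ 2 ≤ 8 / c ^ 2 * a ^ 2 * Real.exp (c / 2 * |t|) := by
    have h : (c / 2 * |t|) ^ 2 / 2 ≤ Real.exp (c / 2 * |t|) := by
      linarith [Real.quadratic_le_exp_of_nonneg (x := c / 2 * |t|) (by positivity),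
        show 0 ≤ c / 2 * |t| by positivity]
    calc |a * t| ^ 2 = 8 / c ^ 2 * a ^ 2 * ((c / 2 * |t|) ^ 2 / 2) := by
          rw [abs_mul, abs_of_nonneg ha]; field_simp; norm_num
      _ ≤ _ := by gcongr
  have exponent : Real.exp |a * t| ≤ Real.exp (c / 2 * |t|) := by
    rw [abs_mul, abs_of_nonneg ha]; gcongr
  have split : Real.exp (c * |t|) = Real.exp (c / 2 * |t|) * Real.exp (c / 2 * |t|) := by
    rw [← Real.exp_add]; ring_nf
  calc Real.exp (a * t) ≤ 1 + a * t + |a * t| ^ 2 * Real.exp |a * t| := taylor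
    _ ≤ 1 + a * t + 8 / c ^ 2 * a ^ 2 * Real.exp (c / 2 * |t|) * Real.exp (c / 2 * |t|) := by
      gcongr
    _ = _ := by rw [split, mul_assoc _ (Real.exp _)]

lemma mgf_le_exp_of_integral_exp_abs_le {Ω : Type*} [MeasurableSpace Ω] {μ : Measure Ω}
    [IsProbabilityMeasure μ] {X : Ω → ℝ} {a c K : ℝ} (hX : Integrable X μ)
    (hexp : Integrable (fun ω => Real.exp (c * |X ω|)) μ) (hmean : ∫ ω, X ω ∂μ = 0)
    (hK : ∫ ω, Real.exp (c * |X ω|) ∂μ ≤ K) (hc : 0 < c) (ha : 0 ≤ a) (hac : a ≤ c / 2) :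
    ProbabilityTheory.mgf X μ a ≤ Real.exp (8 / c ^ 2 * K * a ^ 2) :=
  calc ∫ ω, Real.exp (a * X ω) ∂μ
      ≤ ∫ ω, (1 + a * X ω + 8 / c ^ 2 * a ^ 2 * Real.exp (c * |X ω|)) ∂μ :=
        integral_mono_of_nonneg (.of_forall fun _ => (Real.exp_pos _).le)
          (((integrable_const 1).add (hX.const_mul a)).add (hexp.const_mul _))
          (.of_forall fun _ => exp_mul_le_one_add_mul_add hc ha hac _)
    _ = 1 + 8 / c ^ 2 * a ^ 2 * ∫ ω, Real.exp (c * |X ω|) ∂μ := by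
      have hlin : Integrable (fun ω => 1 + a * X ω) μ := (integrable_const 1).add (hX.const_mul a)
      rw [integral_add hlin (hexp.const_mul _), integral_add (integrable_const 1) (hX.const_mul a),
        integral_const_mul, integral_const_mul, hmean]
      simp
    _ ≤ 1 + 8 / c ^ 2 * a ^ 2 * K := by gcongr
    _ ≤ Real.exp (8 / c ^ 2 * K * a ^ 2) := by
      linarith [Real.add_one_le_exp (8 / c ^ 2 * K * a ^ 2)]

end ExponentialMoments

section OperatorNormTail

open Metric Module
open scoped NNReal

lemma card_le_of_isSeparated_half {E : Type*} [NormedAddCommGroup E] [NormedSpace ℝ E]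
    [FiniteDimensional ℝ E] {s : Finset E} (hs : ↑s ⊆ closedBall (0 : E) 1)
    (hsep : IsSeparated (1 / 2 : ℝ≥0) (s : Set E)) : s.card ≤ 5 ^ finrank ℝ E := by
  classical
  have hinj : Function.Injective fun x : E => (2 : ℝ) • x := smul_right_injective E two_ne_zero
  rw [← Finset.card_image_of_injective s hinj]
  refine Besicovitch.card_le_of_separated _ ?_ ?_
  · simp only [Finset.forall_mem_image, norm_smul, Real.norm_two]
    intro x hx
    linarith [mem_closedBall_zero_iff.1 (hs hx)]
  · simp only [Finset.forall_mem_image, ← smul_sub, norm_smul, Real.norm_two]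
    intro x hx y hy hxy
    have h : ((1 / 2 : ℝ≥0) : ENNReal) < edist x y := hsep hx hy (ne_of_apply_ne _ hxy)
    rw [edist_nndist, ENNReal.coe_lt_coe, ← NNReal.coe_lt_coe, coe_nndist, dist_eq_norm] at h
    push_cast at h
    linarith

lemma packingNumber_half_closedBall_le (E : Type*) [NormedAddCommGroup E] [NormedSpace ℝ E]
    [FiniteDimensional ℝ E] :
    packingNumber (1 / 2) (closedBall (0 : E) 1) ≤ (5 ^ finrank ℝ E : ℕ) := by
  refine iSup₂_le fun C hC => iSup_le fun hsep => ?_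
  by_contra! hcard
  obtain ⟨t, htC, ht⟩ := Set.exists_subset_encard_eq (Order.add_one_le_of_lt hcard)
  lift t to Finset E using Set.finite_of_encard_eq_coe (by exact_mod_cast ht)
  have hle := card_le_of_isSeparated_half (htC.trans hC) (hsep.subset htC)
  rw [Set.encard_coe_eq_coe_finsetCard] at ht
  norm_cast at ht
  omega

lemma exists_isCover_half_closedBall (E : Type*) [NormedAddCommGroup E] [NormedSpace ℝ E]
    [FiniteDimensional ℝ E] :
    ∃ N : Finset E, N.card ≤ 5 ^ finrank ℝ E ∧ (∀ x ∈ N, ‖x‖ ≤ 1) ∧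
      IsCover (1 / 2) (closedBall (0 : E) 1) N := by
  have hpack := packingNumber_half_closedBall_le E
  have hfin := ne_top_of_le_ne_top (ENat.natCast_ne_top _) hpack
  have hcard := (encard_maximalSeparatedSet hfin).trans_le hpack
  have hsub := maximalSeparatedSet_subset (ε := 1 / 2) (A := closedBall (0 : E) 1)
  have hcover := isCover_maximalSeparatedSet hfin
  lift maximalSeparatedSet (1 / 2) (closedBall (0 : E) 1) to Finset E
    using Set.finite_of_encard_le_coe hcard with N
  rw [Set.encard_coe_eq_coe_finsetCard, Nat.cast_le] at hcard
  exact ⟨N, hcard, fun x hx => mem_closedBall_zero_iff.1 (hsub hx), hcover⟩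

lemma exists_norm_sub_le_half_of_isCover {E : Type*} [NormedAddCommGroup E] {N : Set E}
    (hN : IsCover (1 / 2) (closedBall (0 : E) 1) N) {x : E} (hx : ‖x‖ ≤ 1) :
    ∃ y ∈ N, ‖x - y‖ ≤ 1 / 2 := by
  have hmem := isCover_iff_subset_iUnion_closedBall.1 hN (mem_closedBall_zero_iff.2 hx)
  simpa [dist_eq_norm] using hmem

variable {E F : Type*} [NormedAddCommGroup E] [NormedAddCommGroup F]

lemma norm_le_two_mul_of_isCover [InnerProductSpace ℂ F] {N : Set F}
    (hN : IsCover (1 / 2) (closedBall (0 : F) 1) N) {z : F} {t : ℝ}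
    (hz : ∀ x ∈ N, (inner ℂ x z).re ≤ t) : ‖z‖ ≤ 2 * t := by
  have hunit : ‖(‖z‖⁻¹ : ℂ) • z‖ ≤ 1 := by
    rw [norm_smul, norm_inv, Complex.norm_real, norm_norm]
    exact inv_mul_le_one
  obtain ⟨x, hx, hxz⟩ := exists_norm_sub_le_half_of_isCover hN hunit
  have hsplit : ‖z‖ = (inner ℂ x z).re + (inner ℂ ((‖z‖⁻¹ : ℂ) • z - x) z).re := by
    rw [← Complex.add_re, ← inner_add_left, add_sub_cancel, inner_smul_left,
      inner_self_eq_norm_sq_to_K]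
    rcases eq_or_ne z 0 with rfl | hz0
    · simp
    · have := norm_ne_zero_iff.2 hz0
      simp only [map_inv₀, Complex.conj_ofReal, Complex.coe_algebraMap]
      norm_cast
      field_simp
  have herror : (inner ℂ ((‖z‖⁻¹ : ℂ) • z - x) z).re ≤ 1 / 2 * ‖z‖ :=
    (Complex.re_le_norm _).trans ((norm_inner_le_norm _ _).trans (by gcongr))
  linarith [hz x hx]

lemma opNorm_le_two_mul_of_isCover [NormedSpace ℂ E] [NormedSpace ℂ F] {N : Set E}
    (hN : IsCover (1 / 2) (closedBall (0 : E) 1) N) {A : E →L[ℂ] F} {t : ℝ}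
    (hA : ∀ y ∈ N, ‖A y‖ ≤ t) : ‖A‖ ≤ 2 * t := by
  have ht : 0 ≤ t := by
    obtain ⟨y, hy, -⟩ := exists_norm_sub_le_half_of_isCover hN (x := 0) (by simp)
    exact (norm_nonneg _).trans (hA y hy)
  suffices ‖A‖ ≤ t + 1 / 2 * ‖A‖ by linarith
  refine A.opNorm_le_of_unit_norm (by positivity) fun x hx => ?_
  obtain ⟨y, hy, hxy⟩ := exists_norm_sub_le_half_of_isCover hN hx.le
  calc ‖A x‖ = ‖A y + A (x - y)‖ := by rw [← map_add, add_sub_cancel]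
    _ ≤ ‖A y‖ + ‖A‖ * ‖x - y‖ := (norm_add_le _ _).trans (by gcongr; exact A.le_opNorm _)
    _ ≤ t + ‖A‖ * (1 / 2) := by gcongr; exact hA y hy
    _ = t + 1 / 2 * ‖A‖ := by ring

variable [InnerProductSpace ℂ E] [InnerProductSpace ℂ F] [FiniteDimensional ℂ E]
  [FiniteDimensional ℂ F]

lemma measureReal_lt_norm_le {Ω : Type*} [MeasurableSpace Ω] {μ : Measure Ω} [IsFiniteMeasure μ]
    {A : Ω → E →L[ℂ] F} {s B : ℝ} (τ : ℝ) (hs : 0 ≤ s)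
    (hint : ∀ x y, Integrable (fun ω => Real.exp (s * (inner ℂ x (A ω y)).re)) μ)
    (hmgf : ∀ x y, ‖x‖ ≤ 1 → ‖y‖ ≤ 1 →
      ProbabilityTheory.mgf (fun ω => (inner ℂ x (A ω y)).re) μ s ≤ Real.exp B) :
    μ.real {ω | τ < ‖A ω‖} ≤ 25 ^ (finrank ℂ E + finrank ℂ F) * Real.exp (B - s * (τ / 4)) := by
  obtain ⟨N, hNcard, hNball, hN⟩ := exists_isCover_half_closedBall F
  obtain ⟨M, hMcard, hMball, hM⟩ := exists_isCover_half_closedBall E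
  have hunion : {ω | τ < ‖A ω‖} ⊆
      ⋃ p ∈ N ×ˢ M, {ω | τ / 4 ≤ (inner ℂ p.1 (A ω p.2)).re} := by
    intro ω hω
    by_contra! hnot
    simp only [Set.mem_iUnion, Finset.mem_product, Set.mem_ofPred_eq, not_exists, not_le,
      and_imp, Prod.forall] at hnot
    have := opNorm_le_two_mul_of_isCover hM fun y hy =>
      norm_le_two_mul_of_isCover hN fun x hx => (hnot x y hx hy).le
    linarith [Set.mem_ofPred_eq ▸ hω]
  have hchernoff : ∀ p ∈ N ×ˢ M, μ.real {ω | τ / 4 ≤ (inner ℂ p.1 (A ω p.2)).re} ≤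
      Real.exp (B - s * (τ / 4)) := by
    intro p hp
    rw [Finset.mem_product] at hp
    refine (ProbabilityTheory.measure_ge_le_exp_mul_mgf _ hs (hint _ _)).trans ?_
    rw [sub_eq_neg_add, Real.exp_add, neg_mul]
    gcongr
    exact hmgf _ _ (hNball _ hp.1) (hMball _ hp.2)
  calc μ.real {ω | τ < ‖A ω‖}
      ≤ ∑ p ∈ N ×ˢ M, μ.real {ω | τ / 4 ≤ (inner ℂ p.1 (A ω p.2)).re} :=
        (measureReal_mono hunion (measure_ne_top _ _)).trans (measureReal_biUnion_finset_le _ _)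
    _ ≤ ((N.card * M.card : ℕ) : ℝ) * Real.exp (B - s * (τ / 4)) := by
      rw [← Finset.card_product, ← nsmul_eq_mul]
      exact Finset.sum_le_card_nsmul _ _ _ hchernoff
    _ ≤ 25 ^ (finrank ℂ E + finrank ℂ F) * Real.exp (B - s * (τ / 4)) := by
      gcongr
      rw [finrank_real_of_complex, pow_mul] at hNcard hMcard
      rw [add_comm, pow_add]
      exact_mod_cast Nat.mul_le_mul hNcard hMcard

end OperatorNormTail

section RandomPhases

open scoped BigOperators ComplexConjugate

variable {d : ℕ}

/-- The sum `∑ i, x i` in which the `i`-th term is rotated by the conjugate of the fourth root of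
unity `I ^ w i`. For uniformly random `w` it plays the role of a complex Gaussian with variance
`∑ i, ‖x i‖ ^ 2`. -/
def phaseSum (w : Fin d → Fin 4) (x : Fin d → ℂ) : ℂ :=
  ∑ i, conj (Complex.I ^ (w i : ℕ)) * x i

lemma phaseSum_cons (k : Fin 4) (w : Fin d → Fin 4) (x : Fin (d + 1) → ℂ) :
    phaseSum (Fin.cons k w) x = conj (Complex.I ^ (k : ℕ)) * x 0 + phaseSum w (Fin.tail x) := by
  simp [phaseSum, Fin.sum_univ_succ, Fin.tail]

lemma expect_fin_succ {α M : Type*} [Fintype α] [AddCommMonoid M] [Module ℚ≥0 M]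
    (f : (Fin (d + 1) → α) → M) : 𝔼 w, f w = 𝔼 w : Fin d → α, 𝔼 k, f (Fin.cons k w) := by
  rw [← Fintype.expect_equiv (Fin.consEquiv fun _ : Fin (d + 1) => α)
    (fun p => f (Fin.cons p.1 p.2)) f fun _ => rfl, ← Finset.univ_product_univ,
    Finset.expect_product, Finset.expect_comm]

lemma expect_conj_I_pow (f : ℂ → ℂ) :
    𝔼 k : Fin 4, f (conj (Complex.I ^ (k : ℕ))) =
      (f 1 + f (-Complex.I) + f (-1) + f Complex.I) / 4 := by
  simp [Fintype.expect_eq_sum_div_card, Fin.sum_univ_four, pow_succ]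

lemma expect_phase_mul_conj (a b p q : ℂ) :
    𝔼 k : Fin 4, (conj (Complex.I ^ (k : ℕ)) * a + p) * conj (conj (Complex.I ^ (k : ℕ)) * b + q) =
      a * conj b + p * conj q := by
  refine (expect_conj_I_pow fun z => (z * a + p) * conj (z * b + q)).trans ?_
  simp only [map_add, map_mul, map_neg, map_one, Complex.conj_I]
  ring_nf
  simp only [Complex.I_sq]
  ring

lemma expect_phase_fourth_moment (a b c e p q r s : ℂ) :
    𝔼 k : Fin 4, (conj (Complex.I ^ (k : ℕ)) * a + p) * conj (conj (Complex.I ^ (k : ℕ)) * b + q) *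
        ((conj (Complex.I ^ (k : ℕ)) * c + r) * conj (conj (Complex.I ^ (k : ℕ)) * e + s)) =
      a * conj b * (c * conj e) + a * conj b * (r * conj s) + c * conj e * (p * conj q) +
        a * conj e * (r * conj q) + c * conj b * (p * conj s) + p * conj q * (r * conj s) := by
  refine (expect_conj_I_pow fun z =>
    (z * a + p) * conj (z * b + q) * ((z * c + r) * conj (z * e + s))).trans ?_
  simp only [map_add, map_mul, map_neg, map_one, Complex.conj_I]
  ring_nf
  simp only [Complex.I_sq, Complex.I_pow_four]
  ring

lemma expect_phaseSum_mul_conj (x y : Fin d → ℂ) :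
    𝔼 w, phaseSum w x * conj (phaseSum w y) = ∑ i, x i * conj (y i) := by
  induction d with
  | zero => simp [phaseSum]
  | succ d ih =>
    simp only [expect_fin_succ, phaseSum_cons, expect_phase_mul_conj, Finset.expect_add_distrib,
      Fintype.expect_const, ih, Fin.sum_univ_succ, Fin.tail]

lemma expect_phaseSum_fourth_moment (a b c e : Fin d → ℂ) :
    𝔼 w, phaseSum w a * conj (phaseSum w b) * (phaseSum w c * conj (phaseSum w e)) =
      (∑ i, a i * conj (b i)) * (∑ i, c i * conj (e i)) +
        (∑ i, a i * conj (e i)) * (∑ i, c i * conj (b i)) -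
        ∑ i, a i * conj (b i) * (c i * conj (e i)) := by
  induction d with
  | zero => simp [phaseSum]
  | succ d ih =>
    simp only [expect_fin_succ, phaseSum_cons, expect_phase_fourth_moment,
      Finset.expect_add_distrib, ← Finset.mul_expect, Fintype.expect_const,
      expect_phaseSum_mul_conj, ih, Fin.sum_univ_succ, Fin.tail]
    ring

lemma expect_exp_re_phase_mul_le (z : ℂ) :
    𝔼 k : Fin 4, Real.exp (conj (Complex.I ^ (k : ℕ)) * z).re ≤ Real.exp (‖z‖ ^ 2 / 2) := by
  have hcosh : 𝔼 k : Fin 4, Real.exp (conj (Complex.I ^ (k : ℕ)) * z).re =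
      (Real.cosh z.re + Real.cosh z.im) / 2 := by
    simp [Fintype.expect_eq_sum_div_card, Fin.sum_univ_four, pow_succ, Real.cosh_eq]
    ring
  have hre : z.re ^ 2 ≤ ‖z‖ ^ 2 := by
    rw [Complex.sq_norm, sq]; exact Complex.re_sq_le_normSq z
  have him : z.im ^ 2 ≤ ‖z‖ ^ 2 := by
    rw [Complex.sq_norm, sq]; exact Complex.im_sq_le_normSq z
  have hcosh_re : Real.cosh z.re ≤ Real.exp (‖z‖ ^ 2 / 2) :=
    (Real.cosh_le_exp_half_sq _).trans (by gcongr)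
  have hcosh_im : Real.cosh z.im ≤ Real.exp (‖z‖ ^ 2 / 2) :=
    (Real.cosh_le_exp_half_sq _).trans (by gcongr)
  linarith

lemma expect_exp_phase_add_sq_le (c : ℝ) (a p : ℂ) :
    𝔼 k : Fin 4, Real.exp (c * ‖conj (Complex.I ^ (k : ℕ)) * a + p‖ ^ 2) ≤
      Real.exp (c * ‖a‖ ^ 2) * Real.exp (c * (1 + 2 * c * ‖a‖ ^ 2) * ‖p‖ ^ 2) := by
  have hsq : ∀ k : Fin 4, c * ‖conj (Complex.I ^ (k : ℕ)) * a + p‖ ^ 2 =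
      c * ‖a‖ ^ 2 + c * ‖p‖ ^ 2 +
        (conj (Complex.I ^ (k : ℕ)) * ((2 * c : ℝ) * (a * conj p))).re := by
    intro k
    rw [mul_left_comm (conj _), Complex.re_ofReal_mul, Complex.sq_norm, Complex.normSq_add,
      ← Complex.sq_norm, ← Complex.sq_norm, mul_assoc (conj _) a]
    simp only [norm_mul, RCLike.norm_conj, norm_pow, Complex.norm_I, one_pow, one_mul]
    ring
  calc 𝔼 k : Fin 4, Real.exp (c * ‖conj (Complex.I ^ (k : ℕ)) * a + p‖ ^ 2)
      = Real.exp (c * ‖a‖ ^ 2 + c * ‖p‖ ^ 2) *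
          𝔼 k : Fin 4, Real.exp (conj (Complex.I ^ (k : ℕ)) * ((2 * c : ℝ) * (a * conj p))).re := by
        simp only [hsq, Real.exp_add _ (Complex.re _), Finset.mul_expect]
    _ ≤ Real.exp (c * ‖a‖ ^ 2 + c * ‖p‖ ^ 2) *
          Real.exp (‖((2 * c : ℝ) * (a * conj p) : ℂ)‖ ^ 2 / 2) := by
        gcongr
        exact expect_exp_re_phase_mul_le _
    _ = _ := by
        rw [← Real.exp_add, ← Real.exp_add]
        simp only [norm_mul, mul_pow, Complex.norm_real, RCLike.norm_conj, Real.norm_eq_abs, sq_abs]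
        congr 1
        ring

lemma exp_div_one_sub_le {a b : ℝ} (ha : 0 ≤ a) (hb : 0 ≤ b) (hab : 2 * a + b < 1) :
    Real.exp a / (1 - (1 + 2 * a) * b) ≤ 1 / (1 - (2 * a + b)) := by
  have hpos : 0 < 1 - (1 + 2 * a) * b := by nlinarith
  calc Real.exp a / (1 - (1 + 2 * a) * b) ≤ 1 / (1 - a) / (1 - (1 + 2 * a) * b) := by
        gcongr
        exact Real.exp_bound_div_one_sub_of_interval ha (by linarith)
    _ = 1 / ((1 - a) * (1 - (1 + 2 * a) * b)) := by rw [div_div]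
    _ ≤ 1 / (1 - (2 * a + b)) := by
        refine one_div_le_one_div_of_le (by linarith) ?_
        nlinarith [mul_nonneg ha (show 0 ≤ 1 - b by linarith), mul_nonneg (mul_nonneg ha ha) hb]

lemma expect_exp_phaseSum_sq_le (x : Fin d → ℂ) {c : ℝ} (hc : 0 ≤ c)
    (h : 2 * c * ∑ i, ‖x i‖ ^ 2 < 1) :
    𝔼 w, Real.exp (c * ‖phaseSum w x‖ ^ 2) ≤ 1 / (1 - 2 * c * ∑ i, ‖x i‖ ^ 2) := by
  induction d generalizing c with
  | zero => simp [phaseSum]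
  | succ d ih =>
    set S : ℝ := ∑ i, ‖Fin.tail x i‖ ^ 2 with hS
    have hsum : 2 * c * ∑ i, ‖x i‖ ^ 2 = 2 * (c * ‖x 0‖ ^ 2) + 2 * c * S := by
      rw [Fin.sum_univ_succ, hS]; simp only [Fin.tail]; ring
    rw [hsum] at h ⊢
    have ha : 0 ≤ c * ‖x 0‖ ^ 2 := by positivity
    have hb : 0 ≤ 2 * c * S := by positivity
    have hc' : 2 * (c * (1 + 2 * c * ‖x 0‖ ^ 2)) * S = (1 + 2 * (c * ‖x 0‖ ^ 2)) * (2 * c * S) := by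
      ring
    calc 𝔼 w, Real.exp (c * ‖phaseSum w x‖ ^ 2)
        ≤ 𝔼 w : Fin d → Fin 4, Real.exp (c * ‖x 0‖ ^ 2) *
            Real.exp (c * (1 + 2 * c * ‖x 0‖ ^ 2) * ‖phaseSum w (Fin.tail x)‖ ^ 2) := by
          simp only [expect_fin_succ, phaseSum_cons]
          exact Finset.expect_le_expect fun w _ => expect_exp_phase_add_sq_le _ _ _
      _ ≤ Real.exp (c * ‖x 0‖ ^ 2) *
            (1 / (1 - 2 * (c * (1 + 2 * c * ‖x 0‖ ^ 2)) * S)) := by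
          rw [← Finset.mul_expect]
          gcongr
          exact ih (Fin.tail x) (by positivity) (by rw [← hS, hc']; nlinarith)
      _ ≤ 1 / (1 - (2 * (c * ‖x 0‖ ^ 2) + 2 * c * S)) := by
          rw [hc', mul_one_div]
          exact exp_div_one_sub_le ha hb h

end RandomPhases

section Measurement

open scoped BigOperators ComplexConjugate InnerProductSpace

variable {d : ℕ}

/-- The Hilbert space `ℂ^d` of the register. -/
abbrev Ket (d : ℕ) : Type := EuclideanSpace ℂ (Fin d)

/-- The pure states of the register, as unit vectors. -/
abbrev PureState (d : ℕ) : Type := Metric.sphere (0 : Ket d) 1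

/-- A unitary matrix as an operator on the register. -/
def unitaryOp (U : UU d) : Ket d →L[ℂ] Ket d :=
  Matrix.toEuclideanCLM (𝕜 := ℂ) (U : Matrix (Fin d) (Fin d) ℂ)

lemma unitaryOp_apply_apply (U : UU d) (x : Ket d) (i : Fin d) :
    unitaryOp U x i = (U : Matrix (Fin d) (Fin d) ℂ).mulVec x i := rfl

lemma unitaryOp_mem_unitary (U : UU d) : unitaryOp U ∈ unitary (Ket d →L[ℂ] Ket d) :=
  Unitary.map_mem (Matrix.toEuclideanCLM (n := Fin d) (𝕜 := ℂ)) U.2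

lemma norm_unitaryOp_apply (U : UU d) (x : Ket d) : ‖unitaryOp U x‖ = ‖x‖ :=
  ContinuousLinearMap.norm_map_of_mem_unitary (unitaryOp_mem_unitary U) x

/-- The state reached from a pure state by a unitary. -/
def evolve (U : UU d) (v : PureState d) : PureState d :=
  ⟨unitaryOp U v, by rw [mem_sphere_zero_iff_norm, norm_unitaryOp_apply, norm_eq_of_mem_sphere]⟩

variable [NeZero d]

/-- The entries of the unnormalized discrete Fourier transform. -/
def fourier (i k : Fin d) : ℂ :=
  ZMod.stdAddChar (ZMod.finEquiv d i * ZMod.finEquiv d k)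

lemma norm_fourier (i k : Fin d) : ‖fourier i k‖ = 1 := AddChar.norm_apply _ _

lemma sum_conj_fourier_mul (k l : Fin d) :
    ∑ i, conj (fourier i k) * fourier i l = if k = l then (d : ℂ) else 0 := by
  calc ∑ i, conj (fourier i k) * fourier i l
      = ∑ i, ZMod.stdAddChar (ZMod.finEquiv d i * (ZMod.finEquiv d l - ZMod.finEquiv d k)) := by
        refine Finset.sum_congr rfl fun i _ => ?_
        rw [fourier, fourier, ← AddChar.map_neg_eq_conj, ← AddChar.map_add_eq_mul]
        congr 1
        ring
    _ = ∑ i : ZMod d, ZMod.stdAddChar (i * (ZMod.finEquiv d l - ZMod.finEquiv d k)) :=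
        Equiv.sum_comp (ZMod.finEquiv d).toEquiv fun i =>
          ZMod.stdAddChar (i * (ZMod.finEquiv d l - ZMod.finEquiv d k))
    _ = if k = l then (d : ℂ) else 0 := by
        rw [AddChar.sum_mulShift _ (ZMod.isPrimitive_stdAddChar d), ZMod.card]
        simp only [sub_eq_zero, (ZMod.finEquiv d).injective.eq_iff, eq_comm (a := l)]
        split_ifs <;> simp

/-- The `k`-th Fourier vector, with its `i`-th entry rotated by `I ^ w i`. -/
def flatVec (w : Fin d → Fin 4) (k : Fin d) : Ket d :=
  WithLp.toLp 2 fun i => Complex.I ^ (w i : ℕ) * fourier i k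

lemma inner_flatVec_flatVec (w : Fin d → Fin 4) (k l : Fin d) :
    ⟪flatVec w k, flatVec w l⟫_ℂ = if k = l then (d : ℂ) else 0 := by
  rw [← sum_conj_fourier_mul, PiLp.inner_apply]
  refine Finset.sum_congr rfl fun i _ => ?_
  have hphase : Complex.I ^ (w i : ℕ) * conj (Complex.I ^ (w i : ℕ)) = 1 := by
    rw [Complex.mul_conj']
    simp
  simp only [flatVec, RCLike.inner_apply, map_mul]
  linear_combination (conj (fourier i k) * fourier i l) * hphase

/-- The coordinates of `x` multiplied by those of the conjugate `k`-th Fourier vector, so that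
the inner product with `flatVec w k` becomes a `phaseSum`. -/
def fourierTwist (k : Fin d) (x : Ket d) (i : Fin d) : ℂ := conj (fourier i k) * x i

lemma inner_flatVec (w : Fin d → Fin 4) (k : Fin d) (x : Ket d) :
    ⟪flatVec w k, x⟫_ℂ = phaseSum w (fourierTwist k x) := by
  simp only [PiLp.inner_apply, RCLike.inner_apply, phaseSum, fourierTwist, flatVec, map_mul]
  exact Finset.sum_congr rfl fun i _ => by ring

lemma fourierTwist_mul_conj (k i : Fin d) (x y : Ket d) :
    fourierTwist k x i * conj (fourierTwist k y i) = x i * conj (y i) := by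
  have hchar : fourier i k * conj (fourier i k) = 1 := by
    simp [Complex.mul_conj', norm_fourier]
  simp only [fourierTwist, map_mul, Complex.conj_conj]
  linear_combination (x i * conj (y i)) * hchar

lemma sum_norm_fourierTwist_sq (k : Fin d) (x : Ket d) :
    ∑ i, ‖fourierTwist k x i‖ ^ 2 = ‖x‖ ^ 2 := by
  simp only [EuclideanSpace.norm_sq_eq, fourierTwist, norm_mul, RCLike.norm_conj, norm_fourier,
    one_mul]

/-- The randomness that selects the basis of a measurement: `(false, _)` stands for the
computational basis and `(true, w)` for the basis of the vectors `flatVec w k`, normalized. -/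
abbrev TrialSeed (d : ℕ) : Type := Bool × (Fin d → Fin 4)

/-- The matrix that carries the basis selected by the seed to the computational basis. -/
def measMatrix (s : TrialSeed d) : Matrix (Fin d) (Fin d) ℂ :=
  if s.1 then Matrix.of fun k i => ((√d)⁻¹ : ℝ) * conj (flatVec s.2 k i) else 1

lemma measMatrix_mem_unitaryGroup (s : TrialSeed d) :
    measMatrix s ∈ Matrix.unitaryGroup (Fin d) ℂ := by
  obtain ⟨_ | _, w⟩ := s
  · simp [measMatrix]
  rw [Matrix.mem_unitaryGroup_iff]
  ext k l
  have hd : (((√d)⁻¹ : ℝ) : ℂ) * ((√d)⁻¹ : ℝ) * d = 1 := by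
    have hd : (d : ℝ) ≠ 0 := NeZero.ne _
    norm_cast
    rw [← mul_inv, Real.mul_self_sqrt (Nat.cast_nonneg d), inv_mul_cancel₀ hd]
  calc (measMatrix (true, w) * star (measMatrix (true, w))) k l
      = (((√d)⁻¹ : ℝ) : ℂ) * ((√d)⁻¹ : ℝ) * ⟪flatVec w k, flatVec w l⟫_ℂ := by
        rw [Matrix.mul_apply, PiLp.inner_apply, Finset.mul_sum]
        refine Finset.sum_congr rfl fun i _ => ?_
        simp only [measMatrix, if_true, Matrix.star_apply, Matrix.of_apply, RCLike.star_def,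
          map_mul, Complex.conj_conj, Complex.conj_ofReal, RCLike.inner_apply]
        ring
    _ = (1 : Matrix (Fin d) (Fin d) ℂ) k l := by
        rw [inner_flatVec_flatVec, Matrix.one_apply, mul_ite, hd, mul_zero]

/-- `measMatrix` as an element of `U(d)`. -/
def measUnitary (s : TrialSeed d) : UU d := ⟨measMatrix s, measMatrix_mem_unitaryGroup s⟩

lemma unitaryOp_measUnitary_false (w : Fin d → Fin 4) (v : Ket d) :
    unitaryOp (measUnitary (false, w)) v = v := by
  simp [unitaryOp, measUnitary, measMatrix]

lemma norm_unitaryOp_measUnitary_true_sq (w : Fin d → Fin 4) (v : Ket d) (k : Fin d) :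
    ‖unitaryOp (measUnitary (true, w)) v k‖ ^ 2 = (d : ℝ)⁻¹ * ‖⟪flatVec w k, v⟫_ℂ‖ ^ 2 := by
  have hinner : unitaryOp (measUnitary (true, w)) v k = ((√d)⁻¹ : ℝ) * ⟪flatVec w k, v⟫_ℂ := by
    simp only [unitaryOp_apply_apply, Matrix.mulVec, dotProduct, measUnitary, measMatrix, if_true,
      Matrix.of_apply, PiLp.inner_apply, RCLike.inner_apply, Finset.mul_sum]
    exact Finset.sum_congr rfl fun i _ => by ring
  rw [hinner, norm_mul, mul_pow, Complex.norm_real, Real.norm_eq_abs, sq_abs, inv_pow,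
    Real.sq_sqrt (Nat.cast_nonneg d)]

/-- The joint probability of a seed and an outcome when the state `v` is measured in the basis
selected by a uniformly random seed. -/
def trialProb (v : Ket d) (ω : TrialSeed d × Fin d) : ℝ :=
  (2 * 4 ^ d)⁻¹ * ‖unitaryOp (measUnitary ω.1) v ω.2‖ ^ 2

lemma trialProb_nonneg (v : Ket d) (ω : TrialSeed d × Fin d) : 0 ≤ trialProb v ω := by
  unfold trialProb; positivity

lemma sum_trialProb (v : PureState d) : ∑ ω, trialProb (v : Ket d) ω = 1 := by
  simp only [trialProb, Fintype.sum_prod_type, ← Finset.mul_sum, ← EuclideanSpace.norm_sq_eq,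
    norm_unitaryOp_apply, norm_eq_of_mem_sphere]
  simp only [Finset.sum_const, Finset.card_univ, Fintype.card_bool, Fintype.card_pi,
    Fintype.card_fin, Finset.prod_const, nsmul_eq_mul, one_pow, mul_one]
  push_cast
  field_simp

/-- The law of the seed and the outcome of a trial, that is, of one measurement of the state `v`
in a random basis. -/
def trialLaw (v : PureState d) : Measure (TrialSeed d × Fin d) :=
  (PMF.ofFintype (fun ω => ENNReal.ofReal (trialProb (v : Ket d) ω)) (by
    rw [← ENNReal.ofReal_sum_of_nonneg fun ω _ => trialProb_nonneg _ ω, sum_trialProb,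
      ENNReal.ofReal_one])).toMeasure

instance (v : PureState d) : IsProbabilityMeasure (trialLaw v) :=
  inferInstanceAs (IsProbabilityMeasure (PMF.toMeasure _))

lemma trialLaw_singleton (v : PureState d) (ω : TrialSeed d × Fin d) :
    trialLaw v {ω} = ENNReal.ofReal (trialProb v ω) := by
  rw [trialLaw, PMF.toMeasure_apply_singleton _ _ (measurableSet_singleton ω), PMF.ofFintype_apply]

lemma integral_trialLaw {𝕜 : Type*} [RCLike 𝕜] (v : PureState d) (f : TrialSeed d × Fin d → 𝕜) :
    ∫ ω, f ω ∂trialLaw v =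
      (𝔼 k, 𝔼 w, (‖⟪flatVec w k, (v : Ket d)⟫_ℂ‖ ^ 2 : ℝ) * f ((true, w), k)) / 2 +
        (∑ k, (‖(v : Ket d) k‖ ^ 2 : ℝ) * 𝔼 w, f ((false, w), k)) / 2 := by
  have hd : (d : 𝕜) ≠ 0 := NeZero.ne _
  have hsum : ∫ ω, f ω ∂trialLaw v = ∑ ω, (trialProb v ω : 𝕜) * f ω := by
    rw [trialLaw, PMF.integral_eq_sum]
    refine Finset.sum_congr rfl fun ω _ => ?_
    rw [PMF.ofFintype_apply, ENNReal.toReal_ofReal (trialProb_nonneg _ ω),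
      RCLike.real_smul_eq_coe_mul]
  rw [hsum]
  simp only [Fintype.sum_prod_type, Fintype.sum_bool, trialProb, unitaryOp_measUnitary_false,
    norm_unitaryOp_measUnitary_true_sq, Fintype.expect_eq_sum_div_card]
  rw [Finset.sum_comm (γ := Fin d → Fin 4), Finset.sum_comm (γ := Fin d → Fin 4)]
  simp only [Finset.sum_div, Finset.mul_sum]
  congr 1
  all_goals
    refine Finset.sum_congr rfl fun k _ => Finset.sum_congr rfl fun w _ => ?_
    simp only [Fintype.card_pi, Fintype.card_fin, Finset.prod_const, Finset.card_univ]
    push_cast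
    field_simp

/-- The operator computed from a trial. Its mean is the projection onto the measured state. -/
def sampleOp (ω : TrialSeed d × Fin d) : Ket d →L[ℂ] Ket d :=
  if ω.1.1 then
    (2 : ℂ) • (InnerProductSpace.rankOne ℂ (flatVec ω.1.2 ω.2) (flatVec ω.1.2 ω.2) - 1)
  else
    (2 : ℂ) • InnerProductSpace.rankOne ℂ (EuclideanSpace.single ω.2 (1 : ℂ))
      (EuclideanSpace.single ω.2 (1 : ℂ))

lemma inner_sampleOp_true (w : Fin d → Fin 4) (k : Fin d) (x y : Ket d) :
    ⟪x, sampleOp ((true, w), k) y⟫_ℂ =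
      2 * (⟪x, flatVec w k⟫_ℂ * ⟪flatVec w k, y⟫_ℂ - ⟪x, y⟫_ℂ) := by
  simp [sampleOp, mul_comm]

lemma inner_sampleOp_false (w : Fin d → Fin 4) (k : Fin d) (x y : Ket d) :
    ⟪x, sampleOp ((false, w), k) y⟫_ℂ = 2 * (y k * conj (x k)) := by
  simp [sampleOp, EuclideanSpace.inner_single_left, EuclideanSpace.inner_single_right]

lemma expect_inner_sampleOp_true (v : PureState d) (x y : Ket d) (k : Fin d) :
    𝔼 w, (‖⟪flatVec w k, (v : Ket d)⟫_ℂ‖ ^ 2 : ℝ) * ⟪x, sampleOp ((true, w), k) y⟫_ℂ =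
      2 * (⟪x, v⟫_ℂ * ⟪(v : Ket d), y⟫_ℂ -
        ∑ i, (v : Ket d) i * conj ((v : Ket d) i) * (y i * conj (x i))) := by
  have hinner : ∀ x y : Ket d, ∑ i, x i * conj (y i) = ⟪y, x⟫_ℂ := by simp [PiLp.inner_apply]
  have hv : ⟪(v : Ket d), v⟫_ℂ = 1 := by simp [inner_self_eq_norm_sq_to_K]
  set t := fourierTwist k with ht
  have hterm : ∀ w : Fin d → Fin 4,
      (‖⟪flatVec w k, (v : Ket d)⟫_ℂ‖ ^ 2 : ℝ) * ⟪x, sampleOp ((true, w), k) y⟫_ℂ =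
        2 * (phaseSum w (t v) * conj (phaseSum w (t v)) *
            (phaseSum w (t y) * conj (phaseSum w (t x))) -
          ⟪x, y⟫_ℂ * (phaseSum w (t v) * conj (phaseSum w (t v)))) := by
    intro w
    rw [inner_sampleOp_true, ← inner_conj_symm x (flatVec w k), inner_flatVec, inner_flatVec,
      inner_flatVec, Complex.mul_conj', Complex.ofReal_pow]
    ring
  simp only [hterm, ← Finset.mul_expect, Finset.expect_sub_distrib, expect_phaseSum_mul_conj,
    expect_phaseSum_fourth_moment, ht, fourierTwist_mul_conj, hinner, hv]
  ring

lemma integral_inner_sampleOp (v : PureState d) (x y : Ket d) :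
    ∫ ω, ⟪x, sampleOp ω y⟫_ℂ ∂trialLaw v = ⟪x, v⟫_ℂ * ⟪(v : Ket d), y⟫_ℂ := by
  have hsq : ∀ z : ℂ, ((‖z‖ ^ 2 : ℝ) : ℂ) = z * conj z := by simp [Complex.mul_conj']
  rw [integral_trialLaw]
  simp only [RCLike.ofReal_eq_complex_ofReal, expect_inner_sampleOp_true, inner_sampleOp_false,
    Fintype.expect_const]
  simp only [hsq, mul_left_comm _ (2 : ℂ), ← Finset.mul_sum]
  ring

end Measurement

section Moments

open scoped BigOperators ComplexConjugate InnerProductSpace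

lemma exp_add_add_le (a b c : ℝ) :
    Real.exp (a + b + c) ≤ (Real.exp (3 * a) + Real.exp (3 * b) + Real.exp (3 * c)) / 3 := by
  have hcube : ∀ t : ℝ, Real.exp (3 * t) = Real.exp t ^ 3 := fun t => by
    rw [← Real.exp_nat_mul]; norm_num
  have hpos : 0 ≤ Real.exp a + Real.exp b + Real.exp c := by positivity
  rw [hcube, hcube, hcube, Real.exp_add, Real.exp_add]
  nlinarith [mul_nonneg hpos (add_nonneg (add_nonneg (sq_nonneg (Real.exp a - Real.exp b))
    (sq_nonneg (Real.exp b - Real.exp c))) (sq_nonneg (Real.exp a - Real.exp c)))]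

lemma exp_one_sixth_le : Real.exp (1 / 6) ≤ 6 / 5 :=
  (Real.exp_bound_div_one_sub_of_interval (by norm_num) (by norm_num)).trans (by norm_num)

variable {d : ℕ} [NeZero d]

lemma expect_exp_inner_flatVec_sq_le (k : Fin d) {x : Ket d} (hx : ‖x‖ ≤ 1) :
    𝔼 w, Real.exp (1 / 4 * ‖⟪flatVec w k, x⟫_ℂ‖ ^ 2) ≤ 2 := by
  have hx2 : ‖x‖ ^ 2 ≤ 1 := pow_le_one₀ (norm_nonneg x) hx
  simp only [inner_flatVec]
  refine (expect_exp_phaseSum_sq_le (fourierTwist k x) (by norm_num) ?_).trans ?_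
  · rw [sum_norm_fourierTwist_sq]; linarith
  · rw [sum_norm_fourierTwist_sq, div_le_iff₀ (by linarith)]; linarith

variable {x y : Ket d}

lemma norm_inner_sampleOp_true_le (hx : ‖x‖ ≤ 1) (hy : ‖y‖ ≤ 1) (w : Fin d → Fin 4)
    (k : Fin d) :
    ‖⟪x, sampleOp ((true, w), k) y⟫_ℂ‖ ≤
      ‖⟪flatVec w k, x⟫_ℂ‖ ^ 2 + ‖⟪flatVec w k, y⟫_ℂ‖ ^ 2 + 2 := by
  have hxy : ‖⟪x, y⟫_ℂ‖ ≤ 1 :=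
    (norm_inner_le_norm x y).trans (mul_le_one₀ hx (norm_nonneg _) hy)
  have hsub := norm_sub_le (⟪x, flatVec w k⟫_ℂ * ⟪flatVec w k, y⟫_ℂ) ⟪x, y⟫_ℂ
  rw [norm_mul, norm_inner_symm] at hsub
  rw [inner_sampleOp_true, norm_mul, Complex.norm_ofNat]
  nlinarith [sq_nonneg (‖⟪flatVec w k, x⟫_ℂ‖ - ‖⟪flatVec w k, y⟫_ℂ‖)]

lemma norm_inner_sampleOp_false_le (hx : ‖x‖ ≤ 1) (hy : ‖y‖ ≤ 1) (w : Fin d → Fin 4)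
    (k : Fin d) : ‖⟪x, sampleOp ((false, w), k) y⟫_ℂ‖ ≤ 2 := by
  have hcoord : ‖y k‖ * ‖x k‖ ≤ 1 := mul_le_one₀ ((PiLp.norm_apply_le y k).trans hy)
    (norm_nonneg _) ((PiLp.norm_apply_le x k).trans hx)
  rw [inner_sampleOp_false, norm_mul, norm_mul, RCLike.norm_conj, Complex.norm_ofNat]
  linarith

lemma norm_inner_flatVec_sq_mul_exp_le (v : Ket d) (hx : ‖x‖ ≤ 1) (hy : ‖y‖ ≤ 1)
    (w : Fin d → Fin 4) (k : Fin d) :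
    ‖⟪flatVec w k, v⟫_ℂ‖ ^ 2 * Real.exp (1 / 12 * ‖⟪x, sampleOp ((true, w), k) y⟫_ℂ‖) ≤
      24 / 5 * (Real.exp (1 / 4 * ‖⟪flatVec w k, v⟫_ℂ‖ ^ 2) +
        Real.exp (1 / 4 * ‖⟪flatVec w k, x⟫_ℂ‖ ^ 2) +
        Real.exp (1 / 4 * ‖⟪flatVec w k, y⟫_ℂ‖ ^ 2)) := by
  have hnorm := norm_inner_sampleOp_true_le hx hy w k
  set V := ‖⟪flatVec w k, v⟫_ℂ‖ ^ 2
  set A := ‖⟪flatVec w k, x⟫_ℂ‖ ^ 2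
  set B := ‖⟪flatVec w k, y⟫_ℂ‖ ^ 2
  have hV : V ≤ 12 * Real.exp (V / 12) := by linarith [Real.add_one_le_exp (V / 12)]
  have hamgm := exp_add_add_le (V / 12) (A / 12) (B / 12)
  have hthree : ∀ t : ℝ, 3 * (t / 12) = 1 / 4 * t := fun t => by ring
  rw [hthree, hthree, hthree] at hamgm
  calc V * Real.exp (1 / 12 * ‖⟪x, sampleOp ((true, w), k) y⟫_ℂ‖)
      ≤ 12 * Real.exp (V / 12) * Real.exp (1 / 6 + (A / 12 + B / 12)) := by
        gcongr
        linarith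
    _ = 12 * Real.exp (1 / 6) * Real.exp (V / 12 + A / 12 + B / 12) := by
        rw [Real.exp_add (1 / 6), add_assoc, Real.exp_add (V / 12)]; ring
    _ ≤ 12 * (6 / 5) *
          ((Real.exp (1 / 4 * V) + Real.exp (1 / 4 * A) + Real.exp (1 / 4 * B)) / 3) := by
        gcongr
        exact exp_one_sixth_le
    _ = _ := by ring

lemma expect_norm_inner_flatVec_sq_mul_exp_le (v : PureState d) (hx : ‖x‖ ≤ 1) (hy : ‖y‖ ≤ 1)
    (k : Fin d) :
    𝔼 w, ‖⟪flatVec w k, (v : Ket d)⟫_ℂ‖ ^ 2 *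
      Real.exp (1 / 12 * ‖⟪x, sampleOp ((true, w), k) y⟫_ℂ‖) ≤ 144 / 5 := by
  refine (Finset.expect_le_expect fun w _ =>
    norm_inner_flatVec_sq_mul_exp_le (v : Ket d) hx hy w k).trans ?_
  rw [← Finset.mul_expect, Finset.expect_add_distrib, Finset.expect_add_distrib]
  linarith [expect_exp_inner_flatVec_sq_le k (norm_eq_of_mem_sphere v).le,
    expect_exp_inner_flatVec_sq_le k hx, expect_exp_inner_flatVec_sq_le k hy]

lemma integral_exp_norm_inner_sampleOp_le (v : PureState d) (hx : ‖x‖ ≤ 1) (hy : ‖y‖ ≤ 1) :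
    ∫ ω, Real.exp (1 / 12 * ‖⟪x, sampleOp ω y⟫_ℂ‖) ∂trialLaw v ≤ 16 := by
  have hflat : 𝔼 k, 𝔼 w, ‖⟪flatVec w k, (v : Ket d)⟫_ℂ‖ ^ 2 *
      Real.exp (1 / 12 * ‖⟪x, sampleOp ((true, w), k) y⟫_ℂ‖) ≤ 144 / 5 :=
    Finset.expect_le Finset.univ_nonempty fun k _ =>
      expect_norm_inner_flatVec_sq_mul_exp_le v hx hy k
  have hbasis : ∑ k, ‖(v : Ket d) k‖ ^ 2 *
      𝔼 w, Real.exp (1 / 12 * ‖⟪x, sampleOp ((false, w), k) y⟫_ℂ‖) ≤ 6 / 5 := by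
    calc _ ≤ ∑ k, ‖(v : Ket d) k‖ ^ 2 * (6 / 5) := by
          gcongr with k
          refine Finset.expect_le Finset.univ_nonempty fun w _ => ?_
          refine le_trans ?_ exp_one_sixth_le
          gcongr
          linarith [norm_inner_sampleOp_false_le hx hy w k]
      _ = 6 / 5 := by
          rw [← Finset.sum_mul, ← EuclideanSpace.norm_sq_eq, norm_eq_of_mem_sphere]; norm_num
  rw [integral_trialLaw]
  simp only [RCLike.ofReal_real_eq_id, id_eq]
  linarith

/-- The deviation of the operator computed from a trial on the state `v` from its mean. -/
def trialNoise (v : PureState d) (ω : TrialSeed d × Fin d) : Ket d →L[ℂ] Ket d :=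
  sampleOp ω - InnerProductSpace.rankOne ℂ (v : Ket d) (v : Ket d)

lemma inner_trialNoise (v : PureState d) (ω : TrialSeed d × Fin d) (x y : Ket d) :
    ⟪x, trialNoise v ω y⟫_ℂ = ⟪x, sampleOp ω y⟫_ℂ - ⟪x, v⟫_ℂ * ⟪(v : Ket d), y⟫_ℂ := by
  simp [trialNoise, mul_comm]

lemma integral_re_inner_trialNoise (v : PureState d) (x y : Ket d) :
    ∫ ω, (⟪x, trialNoise v ω y⟫_ℂ).re ∂trialLaw v = 0 := by
  have hmean : ∫ ω, ⟪x, trialNoise v ω y⟫_ℂ ∂trialLaw v = 0 := by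
    simp only [inner_trialNoise]
    rw [integral_sub .of_finite .of_finite, integral_inner_sampleOp, integral_const,
      probReal_univ, one_smul, sub_self]
  exact (integral_re (𝕜 := ℂ) .of_finite).trans (by rw [hmean, map_zero])

lemma integral_exp_abs_re_inner_trialNoise_le (v : PureState d) (hx : ‖x‖ ≤ 1) (hy : ‖y‖ ≤ 1) :
    ∫ ω, Real.exp (1 / 12 * |(⟪x, trialNoise v ω y⟫_ℂ).re|) ∂trialLaw v ≤ 18 := by
  have hv := norm_eq_of_mem_sphere v
  have hmean : ‖⟪x, (v : Ket d)⟫_ℂ * ⟪(v : Ket d), y⟫_ℂ‖ ≤ 1 := by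
    rw [norm_mul]
    refine mul_le_one₀ ((norm_inner_le_norm _ _).trans ?_) (norm_nonneg _)
      ((norm_inner_le_norm _ _).trans ?_) <;> simpa [hv]
  have hexp : Real.exp (1 / 12) ≤ 18 / 16 :=
    (Real.exp_bound_div_one_sub_of_interval (by norm_num) (by norm_num)).trans (by norm_num)
  calc ∫ ω, Real.exp (1 / 12 * |(⟪x, trialNoise v ω y⟫_ℂ).re|) ∂trialLaw v
      ≤ ∫ ω, Real.exp (1 / 12) * Real.exp (1 / 12 * ‖⟪x, sampleOp ω y⟫_ℂ‖) ∂trialLaw v := by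
        refine integral_mono .of_finite .of_finite fun ω => ?_
        rw [← Real.exp_add, Real.exp_le_exp]
        have habs := Complex.abs_re_le_norm ⟪x, trialNoise v ω y⟫_ℂ
        have hsub := norm_sub_le ⟪x, sampleOp ω y⟫_ℂ (⟪x, (v : Ket d)⟫_ℂ * ⟪(v : Ket d), y⟫_ℂ)
        rw [← inner_trialNoise] at hsub
        linarith
    _ ≤ 18 / 16 * 16 := by
        rw [integral_const_mul]
        gcongr
        exact integral_exp_norm_inner_sampleOp_le v hx hy
    _ = 18 := by norm_num

lemma integral_exp_re_inner_trialNoise_le (v : PureState d) {a : ℝ} (ha : a ≤ 1 / 24)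
    (hx : ‖x‖ ≤ 1) (hy : ‖y‖ ≤ a) :
    ∫ ω, Real.exp (⟪x, trialNoise v ω y⟫_ℂ).re ∂trialLaw v ≤ Real.exp (144 ^ 2 * a ^ 2) := by
  obtain rfl | hpos := ((norm_nonneg y).trans hy).eq_or_lt
  · simp [norm_le_zero_iff.1 hy]
  have hunit : ‖a⁻¹ • y‖ ≤ 1 := by
    rw [norm_smul, norm_inv, Real.norm_of_nonneg hpos.le]
    exact inv_mul_le_one_of_le₀ hy hpos.le
  have hscale : ∀ ω, (⟪x, trialNoise v ω y⟫_ℂ).re =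
      a * (⟪x, trialNoise v ω (a⁻¹ • y)⟫_ℂ).re := by
    intro ω
    rw [ContinuousLinearMap.map_smul_of_tower, inner_smul_right_eq_smul, Complex.smul_re,
      smul_eq_mul, mul_inv_cancel_left₀ hpos.ne']
  have hmgf := mgf_le_exp_of_integral_exp_abs_le (μ := trialLaw v)
    (X := fun ω => (⟪x, trialNoise v ω (a⁻¹ • y)⟫_ℂ).re) (c := 1 / 12) .of_finite .of_finite
    (integral_re_inner_trialNoise v x _) (integral_exp_abs_re_inner_trialNoise_le v hx hunit)
    (by norm_num) hpos.le (by linarith)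
  simp only [hscale]
  exact hmgf.trans_eq (by norm_num)

end Moments

section IndependentTrials

open scoped InnerProductSpace

variable {d : ℕ} [NeZero d] {ι : Type*} [Fintype ι]

lemma integral_exp_sum_re_inner_trialNoise_le (v : ι → PureState d) {x : Ket d} (hx : ‖x‖ ≤ 1)
    (y : ι → Ket d) (hy : ∀ i, ‖y i‖ ≤ 1 / 24) :
    ∫ ω, Real.exp (∑ i, (⟪x, trialNoise (v i) (ω i) (y i)⟫_ℂ).re)
      ∂Measure.pi (fun i => trialLaw (v i)) ≤ Real.exp (144 ^ 2 * ∑ i, ‖y i‖ ^ 2) := by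
  simp only [Real.exp_sum, Finset.mul_sum]
  rw [integral_fintype_prod_eq_prod
    fun i ω => Real.exp (⟪x, trialNoise (v i) ω (y i)⟫_ℂ).re]
  exact Finset.prod_le_prod (fun i _ => integral_nonneg fun ω => (Real.exp_pos _).le)
    fun i _ => integral_exp_re_inner_trialNoise_le (v i) (hy i) hx le_rfl

lemma measureReal_lt_norm_sum_trialNoise_le (v : ι → PureState d) (R : ι → Ket d →L[ℂ] Ket d)
    {N τ : ℝ} (hN : 0 < N) (hR : ∀ i, ‖R i‖ ≤ 2 / N)
    (hR2 : ∀ y, ∑ i, ‖R i y‖ ^ 2 ≤ 4 / N * ‖y‖ ^ 2) (hτ0 : 0 ≤ τ) (hτ : τ ≤ 1) :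
    (Measure.pi fun i => trialLaw (v i)).real {ω | τ < ‖∑ i, trialNoise (v i) (ω i) ∘L R i‖} ≤
      625 ^ d * Real.exp (-(N * (τ / 2304) ^ 2)) := by
  -- The exponent `288 ^ 2 * s ^ 2 / N - s * τ / 4` is smallest at this `s`.
  set s : ℝ := N * τ / (8 * 288 ^ 2) with hs
  have hs0 : 0 ≤ s := by positivity
  have hmgf : ∀ x y : Ket d, ‖x‖ ≤ 1 → ‖y‖ ≤ 1 →
      ProbabilityTheory.mgf
        (fun ω => (⟪x, (∑ i, trialNoise (v i) (ω i) ∘L R i) y⟫_ℂ).re)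
        (Measure.pi fun i => trialLaw (v i)) s ≤ Real.exp (144 ^ 2 * (s ^ 2 * (4 / N))) := by
    intro x y hx hy
    have hsum : ∀ ω : ι → TrialSeed d × Fin d,
        s * (⟪x, (∑ i, trialNoise (v i) (ω i) ∘L R i) y⟫_ℂ).re =
          ∑ i, (⟪x, trialNoise (v i) (ω i) (s • R i y)⟫_ℂ).re := by
      intro ω
      simp only [sum_apply, ContinuousLinearMap.comp_apply, inner_sum, Complex.re_sum,
        ContinuousLinearMap.map_smul_of_tower, inner_smul_right_eq_smul, Complex.smul_re,
        smul_eq_mul, Finset.mul_sum]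
    simp only [ProbabilityTheory.mgf, hsum]
    refine (integral_exp_sum_re_inner_trialNoise_le v hx _ fun i => ?_).trans ?_
    · rw [norm_smul, Real.norm_of_nonneg hs0]
      calc s * ‖R i y‖ ≤ s * (2 / N * 1) := by
            gcongr
            exact (R i).le_of_opNorm_le_of_le (hR i) hy
        _ = τ / (4 * 288 ^ 2) := by rw [hs]; field_simp; ring
        _ ≤ 1 / 24 := by linarith
    · simp only [norm_smul, mul_pow, Real.norm_of_nonneg hs0, ← Finset.mul_sum]
      gcongr
      calc ∑ i, ‖R i y‖ ^ 2 ≤ 4 / N * ‖y‖ ^ 2 := hR2 y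
        _ ≤ 4 / N := mul_le_of_le_one_right (by positivity) (pow_le_one₀ (norm_nonneg y) hy)
  refine (measureReal_lt_norm_le τ hs0 (fun x y => .of_finite) hmgf).trans_eq ?_
  rw [finrank_euclideanSpace_fin, ← two_mul, pow_mul, hs]
  congr 2
  · norm_num
  · field_simp
    ring

/-- The average of the operators computed from a family of trials. -/
def meanOp (ω : ι → TrialSeed d × Fin d) : Ket d →L[ℂ] Ket d :=
  (Fintype.card ι : ℝ)⁻¹ • ∑ i, sampleOp (ω i)

lemma meanOp_sub_rankOne [Nonempty ι] (v : PureState d) (ω : ι → TrialSeed d × Fin d) :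
    meanOp ω - InnerProductSpace.rankOne ℂ (v : Ket d) (v : Ket d) =
      (Fintype.card ι : ℝ)⁻¹ • ∑ i, trialNoise v (ω i) := by
  have hcard : (Fintype.card ι : ℝ) ≠ 0 := by positivity
  simp only [trialNoise, Finset.sum_sub_distrib, Finset.sum_const, Finset.card_univ, meanOp,
    smul_sub, ← Nat.cast_smul_eq_nsmul ℝ, inv_smul_smul₀ hcard]

lemma measureReal_lt_norm_meanOp_sub_le [Nonempty ι] (v : PureState d) {τ : ℝ} (hτ0 : 0 ≤ τ)
    (hτ : τ ≤ 1) :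
    (Measure.pi fun _ : ι => trialLaw v).real
        {ω | τ < ‖meanOp ω - InnerProductSpace.rankOne ℂ (v : Ket d) (v : Ket d)‖} ≤
      625 ^ d * Real.exp (-(Fintype.card ι * (τ / 2304) ^ 2)) := by
  have hcard : (0 : ℝ) < Fintype.card ι := by positivity
  have hnorm : ∀ y : Ket d, ‖(Fintype.card ι : ℝ)⁻¹ • y‖ = ‖y‖ / Fintype.card ι := fun y => by
    rw [norm_smul, Real.norm_of_nonneg (by positivity), div_eq_inv_mul]
  have htail := measureReal_lt_norm_sum_trialNoise_le (fun _ : ι => v)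
    (fun _ => (Fintype.card ι : ℝ)⁻¹ • ContinuousLinearMap.id ℂ (Ket d)) hcard
    (fun _ => ContinuousLinearMap.opNorm_le_bound _ (by positivity) fun y => ?_) (fun y => ?_)
    hτ0 hτ
  · simpa only [ContinuousLinearMap.comp_smul, ContinuousLinearMap.comp_id, meanOp_sub_rankOne,
      Finset.smul_sum] using htail
  · simp only [smul_apply, ContinuousLinearMap.id_apply, hnorm]
    rw [div_mul_eq_mul_div]
    gcongr
    linarith [norm_nonneg y]
  · simp only [smul_apply, ContinuousLinearMap.id_apply, hnorm, Finset.sum_const, Finset.card_univ,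
      nsmul_eq_mul]
    calc (Fintype.card ι : ℝ) * (‖y‖ / Fintype.card ι) ^ 2 = 1 / Fintype.card ι * ‖y‖ ^ 2 := by
          field_simp
      _ ≤ 4 / Fintype.card ι * ‖y‖ ^ 2 := by gcongr; norm_num

end IndependentTrials

section StateRecovery

variable {𝕜 E : Type*} [RCLike 𝕜] [NormedAddCommGroup E] [InnerProductSpace 𝕜 E]

open InnerProductSpace (rankOne)

lemma norm_two_smul_rankOne_sub_apply {v : E} (hv : ‖v‖ = 1) (x : E) :
    ‖(2 : 𝕜) • rankOne 𝕜 v v x - x‖ = ‖x‖ := by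
  rw [← (Submodule.span 𝕜 {v}).reflection.norm_map x, Submodule.reflection_singleton_apply, hv]
  simp [ofNat_smul_eq_nsmul]

lemma two_smul_rankOne_normalize_add_apply {x y : E} (hnorm : ‖x‖ = ‖y‖)
    (hinner : inner 𝕜 x y = inner 𝕜 y x) (hne : x + y ≠ 0) {v : E}
    (hv : v = (‖x + y‖⁻¹ : 𝕜) • (x + y)) : (2 : 𝕜) • rankOne 𝕜 v v x - x = y := by
  have hsq : (‖x + y‖ : 𝕜) ^ 2 = 2 * inner 𝕜 (x + y) x := by
    rw [← inner_self_eq_norm_sq_to_K, inner_add_right, inner_add_left, inner_add_left, hinner,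
      inner_self_eq_norm_sq_to_K, inner_self_eq_norm_sq_to_K, hnorm]
    ring
  have hne' : (‖x + y‖ : 𝕜) ≠ 0 := by simpa using hne
  have hcoef : (2 : 𝕜) * ((‖x + y‖ : 𝕜)⁻¹ * inner 𝕜 (x + y) x) * (‖x + y‖ : 𝕜)⁻¹ = 1 := by
    field_simp
    rw [hsq]
  rw [hv, InnerProductSpace.rankOne_apply, inner_smul_left, map_inv₀, RCLike.conj_ofReal,
    smul_smul, smul_smul, hcoef, one_smul, add_sub_cancel_left]

lemma exists_norm_sub_smul_le_two_mul_norm_rankOne_sub {r z : E} (hr : ‖r‖ = 1) (hz : ‖z‖ = 1) :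
    ∃ c : 𝕜, ‖c‖ = 1 ∧ ‖r - c • z‖ ≤ 2 * ‖rankOne 𝕜 r r - rankOne 𝕜 z z‖ := by
  set g : 𝕜 := inner 𝕜 r z
  obtain ⟨c, hc, hcg⟩ := RCLike.exists_norm_eq_mul_self g
  refine ⟨c, hc, ?_⟩
  have hg0 : 0 ≤ ‖g‖ := norm_nonneg g
  have hg1 : ‖g‖ ≤ 1 := by simpa [hr, hz] using norm_inner_le_norm (𝕜 := 𝕜) r z
  have hproj : ‖r - inner 𝕜 z r • z‖ ≤ ‖rankOne 𝕜 r r - rankOne 𝕜 z z‖ := by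
    simpa [inner_self_eq_norm_sq_to_K, hr] using (rankOne 𝕜 r r - rankOne 𝕜 z z).le_opNorm r
  have hproj_sq : ‖r - inner 𝕜 z r • z‖ ^ 2 = 1 - ‖g‖ ^ 2 := by
    rw [@norm_sub_sq 𝕜, inner_smul_right, hr, norm_smul, hz, norm_inner_symm, mul_comm,
      inner_mul_symm_re_eq_norm, norm_mul, norm_inner_symm z r]
    ring
  have hphase_sq : ‖r - c • z‖ ^ 2 = 2 - 2 * ‖g‖ := by
    rw [@norm_sub_sq 𝕜, inner_smul_right, ← hcg, RCLike.ofReal_re, hr, norm_smul, hc, hz]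
    ring
  refine le_trans ?_ (mul_le_mul_of_nonneg_left hproj zero_le_two)
  refine le_of_sq_le_sq ?_ (by positivity)
  rw [mul_pow, hproj_sq, hphase_sq]
  nlinarith

end StateRecovery

section Reconstruction

open InnerProductSpace (rankOne)

variable {d : ℕ}

lemma continuous_unitaryOp : Continuous (unitaryOp (d := d)) :=
  (LinearMap.continuous_of_finiteDimensional
    (Matrix.toEuclideanCLM (n := Fin d) (𝕜 := ℂ)).toAlgEquiv.toLinearMap).comp
    continuous_subtype_val

lemma opNorm_smul_sub (φ : ℂ) (U V : UU d) :
    opNorm (φ • (U : Matrix (Fin d) (Fin d) ℂ) - (V : Matrix (Fin d) (Fin d) ℂ)) =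
      ‖φ • unitaryOp U - unitaryOp V‖ := by
  rw [opNorm, map_sub, map_smul, unitaryOp, unitaryOp]

lemma phaseDist_le_norm_smul_sub {c : ℂ} (hc : ‖c‖ = 1) (U V : UU d) :
    phaseDist U V ≤ ‖c • unitaryOp U - unitaryOp V‖ := by
  rw [← opNorm_smul_sub]
  refine ciInf_le ⟨0, ?_⟩ (⟨c, mem_sphere_zero_iff_norm.2 hc⟩ : Circle)
  rintro _ ⟨φ, rfl⟩
  exact norm_nonneg _

lemma phaseDist_le_two (U V : UU d) : phaseDist U V ≤ 2 := by
  refine (phaseDist_le_norm_smul_sub norm_one U V).trans ?_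
  refine ContinuousLinearMap.opNorm_le_bound _ zero_le_two fun x => ?_
  calc ‖((1 : ℂ) • unitaryOp U - unitaryOp V) x‖ ≤ ‖unitaryOp U x‖ + ‖unitaryOp V x‖ := by
        rw [one_smul]
        exact norm_sub_le _ _
    _ = 2 * ‖x‖ := by rw [norm_unitaryOp_apply, norm_unitaryOp_apply, two_mul]

lemma measurableSet_phaseDist_le (U : UU d) (ε : ℝ) :
    MeasurableSet {V : UU d | phaseDist U V ≤ ε} := by
  have husc : UpperSemicontinuous fun V : UU d => phaseDist U V := by
    refine upperSemicontinuous_ciInf (fun V => ⟨0, ?_⟩) fun φ => ?_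
    · rintro _ ⟨φ, rfl⟩
      exact norm_nonneg _
    · simp only [opNorm_smul_sub]
      exact (continuous_const.sub continuous_unitaryOp).norm.upperSemicontinuous
  exact husc.measurable measurableSet_Iic

instance : CompactSpace (UU d) := by
  refine isCompact_iff_compactSpace.1 (IsCompact.of_isClosed_subset
    (isCompact_univ_pi fun _ => isCompact_univ_pi fun _ => isCompact_closedBall (0 : ℂ) 1)
    isClosed_unitary fun U hU i _ j _ => ?_)
  rw [mem_closedBall_zero_iff]
  exact entry_norm_bound_of_unitary hU i j

lemma exists_nearestUnitary (A : Ket d →L[ℂ] Ket d) :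
    ∃ V : UU d, ∀ U : UU d, ‖A - unitaryOp V‖ ≤ ‖A - unitaryOp U‖ := by
  obtain ⟨V, -, hV⟩ := isCompact_univ.exists_isMinOn Set.univ_nonempty
    (continuous_const.sub continuous_unitaryOp).norm.continuousOn (f := fun U => ‖A - unitaryOp U‖)
  exact ⟨V, fun U => hV (Set.mem_univ U)⟩

/-- A unitary closest to an operator, to round estimates of the unknown unitary to `U(d)`. -/
def nearestUnitary (A : Ket d →L[ℂ] Ket d) : UU d := (exists_nearestUnitary A).choose

lemma norm_sub_unitaryOp_nearestUnitary_le (A : Ket d →L[ℂ] Ket d) (U : UU d) :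
    ‖A - unitaryOp (nearestUnitary A)‖ ≤ ‖A - unitaryOp U‖ :=
  (exists_nearestUnitary A).choose_spec U

lemma exists_unitaryOp_eq_smul {c : ℂ} (hc : ‖c‖ = 1) (U : UU d) :
    ∃ V : UU d, unitaryOp V = c • unitaryOp U := by
  refine ⟨⟨c • (U : Matrix (Fin d) (Fin d) ℂ), ?_⟩, map_smul _ _ _⟩
  rw [Matrix.mem_unitaryGroup_iff, star_smul, Matrix.smul_mul, Matrix.mul_smul, smul_smul,
    Matrix.mem_unitaryGroup_iff.1 U.2, RCLike.star_def, RCLike.mul_conj, hc]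
  simp

lemma phaseDist_nearestUnitary_le {c : ℂ} (hc : ‖c‖ = 1) (U : UU d) (A : Ket d →L[ℂ] Ket d) :
    phaseDist U (nearestUnitary A) ≤ 2 * ‖A - c • unitaryOp U‖ := by
  obtain ⟨V, hV⟩ := exists_unitaryOp_eq_smul hc U
  calc phaseDist U (nearestUnitary A)
      ≤ ‖c • unitaryOp U - unitaryOp (nearestUnitary A)‖ := phaseDist_le_norm_smul_sub hc _ _
    _ ≤ ‖c • unitaryOp U - A‖ + ‖A - unitaryOp (nearestUnitary A)‖ :=
        norm_sub_le_norm_sub_add_norm_sub _ _ _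
    _ ≤ ‖A - c • unitaryOp U‖ + ‖A - c • unitaryOp U‖ := by
        rw [norm_sub_rev, ← hV]
        gcongr
        exact norm_sub_unitaryOp_nearestUnitary_le A V
    _ = 2 * ‖A - c • unitaryOp U‖ := (two_mul _).symm

/-- The operator on `ℂ^d` with columns `f 0, f 1, …`. -/
def columnsOp (f : Fin d → Ket d) : Ket d →L[ℂ] Ket d :=
  ∑ j, rankOne ℂ (f j) (EuclideanSpace.single j (1 : ℂ))

lemma columnsOp_apply (f : Fin d → Ket d) (y : Ket d) : columnsOp f y = ∑ j, y j • f j := by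
  simp [columnsOp, EuclideanSpace.inner_single_left]

lemma columnsOp_sub (f g : Fin d → Ket d) : columnsOp f - columnsOp g = columnsOp (f - g) := by
  simp [columnsOp]

lemma columnsOp_apply_single (A : Ket d →L[ℂ] Ket d) :
    (columnsOp fun j => A (EuclideanSpace.single j 1)) = A := by
  ext1 y
  conv_rhs => rw [← (EuclideanSpace.basisFun (Fin d) ℂ).sum_repr y]
  simp [columnsOp_apply]

lemma norm_columnsOp_le (f : Fin d → Ket d) {D : ℝ} (hD : 0 ≤ D) (hf : ∀ j, ‖f j‖ ≤ D) :
    ‖columnsOp f‖ ≤ D * √d := by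
  refine ContinuousLinearMap.opNorm_le_bound _ (by positivity) fun y => ?_
  have hcauchy : ∑ j, ‖y j‖ ≤ √d * ‖y‖ := by
    refine le_of_sq_le_sq ?_ (by positivity)
    rw [mul_pow, Real.sq_sqrt (Nat.cast_nonneg d), EuclideanSpace.norm_sq_eq]
    simpa using sq_sum_le_card_mul_sum_sq (s := Finset.univ) (f := fun j => ‖y j‖)
  calc ‖columnsOp f y‖ ≤ ∑ j, ‖y j • f j‖ := by
        rw [columnsOp_apply]
        exact norm_sum_le _ _
    _ ≤ ∑ j, ‖y j‖ * D := by
        gcongr with j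
        rw [norm_smul]
        gcongr
        exact hf j
    _ ≤ D * √d * ‖y‖ := by
        rw [← Finset.sum_mul, mul_comm, mul_assoc]
        gcongr

variable [NeZero d]

lemma single_zero_add_single_ne_zero (j : Fin d) :
    EuclideanSpace.single 0 (1 : ℂ) + EuclideanSpace.single j (1 : ℂ) ≠ (0 : Ket d) := by
  intro h
  have h0 := congrArg (fun x : Ket d => x 0) h
  rcases eq_or_ne j 0 with rfl | hj
  · norm_num at h0
  · simp [hj.symm] at h0

/-- The superposition of the basis states `0` and `j`, which gives access to the phase between
the columns `0` and `j` of the unknown unitary. For `j = 0` it is the basis state `0`. -/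
def probe (j : Fin d) : PureState d :=
  ⟨((‖EuclideanSpace.single 0 (1 : ℂ) + EuclideanSpace.single j (1 : ℂ)‖ : ℂ)⁻¹) •
    (EuclideanSpace.single 0 1 + EuclideanSpace.single j 1), by
    rw [mem_sphere_zero_iff_norm]
    exact norm_smul_inv_norm (single_zero_add_single_ne_zero j)⟩

lemma probe_zero : (probe (0 : Fin d) : Ket d) = EuclideanSpace.single 0 1 := by
  simp only [probe, ← two_smul ℂ, norm_smul]
  simp

lemma exists_nearestState (M : Ket d →L[ℂ] Ket d) :
    ∃ r : PureState d, ∀ v : PureState d,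
      ‖M - rankOne ℂ (r : Ket d) (r : Ket d)‖ ≤ ‖M - rankOne ℂ (v : Ket d) (v : Ket d)‖ := by
  have hcont : Continuous fun v : PureState d => ‖M - rankOne ℂ (v : Ket d) (v : Ket d)‖ := by
    simp only [InnerProductSpace.rankOne_def]
    fun_prop
  obtain ⟨r, -, hr⟩ := isCompact_univ.exists_isMinOn ⟨probe 0, Set.mem_univ _⟩ hcont.continuousOn
  exact ⟨r, fun v => hr (Set.mem_univ v)⟩

/-- A pure state whose projection is closest to an operator, to read off a state from an estimate
of its projection. -/
def nearestState (M : Ket d →L[ℂ] Ket d) : PureState d := (exists_nearestState M).choose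

lemma exists_norm_nearestState_sub_smul_le (M : Ket d →L[ℂ] Ket d) (v : PureState d) :
    ∃ c : ℂ, ‖c‖ = 1 ∧ ‖(nearestState M : Ket d) - c • (v : Ket d)‖ ≤
      4 * ‖M - rankOne ℂ (v : Ket d) (v : Ket d)‖ := by
  set r := nearestState M
  have hr : ‖M - rankOne ℂ (r : Ket d) (r : Ket d)‖ ≤ ‖M - rankOne ℂ (v : Ket d) (v : Ket d)‖ :=
    (exists_nearestState M).choose_spec v
  obtain ⟨c, hc, hrc⟩ := exists_norm_sub_smul_le_two_mul_norm_rankOne_sub (𝕜 := ℂ)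
    (norm_eq_of_mem_sphere r) (norm_eq_of_mem_sphere v)
  have htri := norm_sub_le_norm_sub_add_norm_sub (rankOne ℂ (r : Ket d) (r : Ket d)) M
    (rankOne ℂ (v : Ket d) (v : Ket d))
  rw [norm_sub_rev _ M] at htri
  exact ⟨c, hc, by linarith⟩

lemma two_smul_rankOne_evolve_probe_apply (Z : UU d) (j : Fin d) :
    (2 : ℂ) • rankOne ℂ (evolve Z (probe j) : Ket d) (evolve Z (probe j) : Ket d)
        (unitaryOp Z (EuclideanSpace.single 0 1)) - unitaryOp Z (EuclideanSpace.single 0 1) =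
      unitaryOp Z (EuclideanSpace.single j 1) := by
  have hinner : ∀ x y, inner ℂ (unitaryOp Z x) (unitaryOp Z y) = inner ℂ x y :=
    ContinuousLinearMap.inner_map_map_of_mem_unitary (unitaryOp_mem_unitary Z)
  refine two_smul_rankOne_normalize_add_apply ?_ ?_ ?_ ?_
  · simp [norm_unitaryOp_apply]
  · simp [hinner, EuclideanSpace.inner_single_left, eq_comm (a := j)]
  · rw [← map_add, ← norm_ne_zero_iff, norm_unitaryOp_apply, norm_ne_zero_iff]
    exact single_zero_add_single_ne_zero j
  · rw [← map_add, norm_unitaryOp_apply, ← map_smul]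
    rfl

variable {κ : Type*} [Fintype κ]

/-- The estimate of the unknown unitary, up to a phase, from a family `κ` of trials on the image of
each probe state, and a vector `r` close to the image of the basis state `0`. -/
def estimateOp (r : Ket d) (ω : Fin d × κ → TrialSeed d × Fin d) : Ket d →L[ℂ] Ket d :=
  columnsOp fun j => (2 : ℂ) • meanOp (fun k => ω (j, k)) r - r

/-- What `estimateOp` estimates: each average is replaced by its expectation. -/
def idealOp (Z : UU d) (r : Ket d) : Ket d →L[ℂ] Ket d :=
  columnsOp fun j =>
    (2 : ℂ) • rankOne ℂ (evolve Z (probe j) : Ket d) (evolve Z (probe j) : Ket d) r - r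

lemma norm_idealOp_sub_smul_le (Z : UU d) (r : Ket d) (c : ℂ) :
    ‖idealOp Z r - c • unitaryOp Z‖ ≤ ‖r - c • unitaryOp Z (EuclideanSpace.single 0 1)‖ * √d := by
  rw [← columnsOp_apply_single (c • unitaryOp Z), idealOp, columnsOp_sub]
  refine norm_columnsOp_le _ (norm_nonneg _) fun j => le_of_eq ?_
  rw [← norm_two_smul_rankOne_sub_apply (𝕜 := ℂ) (norm_eq_of_mem_sphere (evolve Z (probe j)))
    (r - c • unitaryOp Z (EuclideanSpace.single 0 1))]
  congr 1
  simp only [Pi.sub_apply, smul_apply, map_sub, map_smul]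
  rw [← two_smul_rankOne_evolve_probe_apply Z j]
  module

lemma estimateOp_sub_idealOp [Nonempty κ] (Z : UU d) (r : Ket d)
    (ω : Fin d × κ → TrialSeed d × Fin d) :
    estimateOp r ω - idealOp Z r = ∑ i, trialNoise (evolve Z (probe i.1)) (ω i) ∘L
      rankOne ℂ ((2 / Fintype.card κ : ℝ) • r) (EuclideanSpace.single i.1 1) := by
  rw [Fintype.sum_prod_type, estimateOp, idealOp, columnsOp_sub, columnsOp]
  refine Finset.sum_congr rfl fun j _ => ?_
  have hcolumn : (2 : ℂ) • (meanOp (fun k => ω (j, k)) -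
      rankOne ℂ (evolve Z (probe j) : Ket d) (evolve Z (probe j) : Ket d)) r =
      ∑ k, trialNoise (evolve Z (probe j)) (ω (j, k)) ((2 / Fintype.card κ : ℝ) • r) := by
    simp only [meanOp_sub_rankOne, ContinuousLinearMap.map_smul_of_tower, ← Finset.smul_sum,
      smul_apply, sum_apply, div_eq_mul_inv, mul_smul]
    rw [two_smul ℂ, two_smul ℝ]
  simp only [InnerProductSpace.comp_rankOne]
  rw [← sum_apply, ← map_sum, ← hcolumn]
  congr 2
  simp only [Pi.sub_apply, sub_apply]
  module

lemma measureReal_lt_norm_estimateOp_sub_le [Nonempty κ] (Z : UU d) (r : PureState d) {τ : ℝ}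
    (hτ0 : 0 ≤ τ) (hτ : τ ≤ 1) :
    (Measure.pi fun i : Fin d × κ => trialLaw (evolve Z (probe i.1))).real
        {ω | τ < ‖estimateOp (r : Ket d) ω - idealOp Z r‖} ≤
      625 ^ d * Real.exp (-(Fintype.card κ * (τ / 2304) ^ 2)) := by
  have hcard : (0 : ℝ) < Fintype.card κ := by positivity
  have hr : ‖(2 / Fintype.card κ : ℝ) • (r : Ket d)‖ = 2 / Fintype.card κ := by
    rw [norm_smul, norm_eq_of_mem_sphere, mul_one, Real.norm_of_nonneg (by positivity)]
  simp only [estimateOp_sub_idealOp]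
  refine measureReal_lt_norm_sum_trialNoise_le _ _ hcard (fun i => ?_) (fun y => le_of_eq ?_)
    hτ0 hτ
  · simp only [InnerProductSpace.norm_rankOne, hr, PiLp.norm_single, norm_one, mul_one, le_refl]
  · simp only [InnerProductSpace.rankOne_apply, EuclideanSpace.inner_single_left, norm_smul, hr,
      Fintype.sum_prod_type, mul_pow, Finset.sum_const, Finset.card_univ, nsmul_eq_mul,
      ← Finset.mul_sum, ← Finset.sum_mul, EuclideanSpace.norm_sq_eq y, map_one, one_mul]
    field_simp
    norm_num

/-- The output computed from the outcomes of the trials on the images of the basis state `0` and of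
all probe states. -/
def decode {ι : Type*} [Fintype ι] (ω₁ : ι → TrialSeed d × Fin d)
    (ω₂ : Fin d × κ → TrialSeed d × Fin d) : UU d :=
  nearestUnitary (estimateOp (nearestState (meanOp ω₁) : Ket d) ω₂)

lemma phaseDist_decode_le {ι : Type*} [Fintype ι] (Z : UU d) (ω₁ : ι → TrialSeed d × Fin d)
    (ω₂ : Fin d × κ → TrialSeed d × Fin d) {δ τ : ℝ}
    (h₁ : ‖meanOp ω₁ -
      rankOne ℂ (evolve Z (probe 0) : Ket d) (evolve Z (probe 0) : Ket d)‖ ≤ δ)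
    (h₂ : ‖estimateOp (nearestState (meanOp ω₁) : Ket d) ω₂ -
      idealOp Z (nearestState (meanOp ω₁))‖ ≤ τ) :
    phaseDist Z (decode ω₁ ω₂) ≤ 2 * (τ + 4 * δ * √d) := by
  obtain ⟨c, hc, hr⟩ := exists_norm_nearestState_sub_smul_le (meanOp ω₁) (evolve Z (probe 0))
  have hideal := norm_idealOp_sub_smul_le Z (nearestState (meanOp ω₁)) c
  rw [← probe_zero] at hideal
  refine (phaseDist_nearestUnitary_le hc Z _).trans ?_
  gcongr
  refine (norm_sub_le_norm_sub_add_norm_sub _ _ _).trans (add_le_add h₂ (hideal.trans ?_))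
  gcongr
  exact hr.trans (by gcongr)

end Reconstruction

section ProductMeasures

lemma map_pi_comp_sum_equiv {ι ι' κ X : Type*} [Fintype ι] [Fintype ι'] [Fintype κ]
    [MeasurableSpace X] (μ : ι ⊕ ι' → Measure X) [∀ i, SigmaFinite (μ i)] (e : κ ≃ ι ⊕ ι') :
    (Measure.pi fun t => μ (e t)).map
        (fun ω => (fun i => ω (e.symm (.inl i)), fun i => ω (e.symm (.inr i)))) =
      (Measure.pi fun i => μ (.inl i)).prod (Measure.pi fun i => μ (.inr i)) := by
  have hreindex (ω : κ → X) : MeasurableEquiv.piCongrLeft (fun _ => X) e ω = ω ∘ e.symm := by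
    ext1 i
    obtain ⟨t, rfl⟩ := e.surjective i
    simp [MeasurableEquiv.coe_piCongrLeft, Equiv.piCongrLeft_apply_apply]
  rw [← ((measurePreserving_sumPiEquivProdPi μ).comp (measurePreserving_piCongrLeft μ e)).map_eq]
  congr 1
  ext1 ω
  simp only [Function.comp_apply, hreindex]
  rfl

lemma measure_prod_le_add {α β : Type*} [MeasurableSpace α] [MeasurableSpace β] (μ : Measure α)
    [IsProbabilityMeasure μ] (ν : Measure β) [IsProbabilityMeasure ν] {S : Set (α × β)}
    (hS : MeasurableSet S) {B : Set α} (hB : MeasurableSet B) {b : ENNReal}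
    (hb : ∀ x ∉ B, ν (Prod.mk x ⁻¹' S) ≤ b) : μ.prod ν S ≤ μ B + b := by
  rw [Measure.prod_apply hS]
  calc ∫⁻ x, ν (Prod.mk x ⁻¹' S) ∂μ ≤ ∫⁻ x, (B.indicator 1 x + b) ∂μ := by
        refine lintegral_mono fun x => ?_
        by_cases hx : x ∈ B
        · simpa [hx] using prob_le_one.trans le_self_add
        · simpa [hx] using hb x hx
    _ = μ B + b := by
        rw [lintegral_add_right _ measurable_const, lintegral_indicator_one hB, lintegral_const,
          measure_univ, mul_one]

end ProductMeasures

section TrialsAlgorithm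

variable {d : ℕ}

lemma exists_unitary_mulVec_single (i : Fin d) (p : PureState d) :
    ∃ U : UU d, (U : Matrix (Fin d) (Fin d) ℂ).mulVec (Pi.single i 1) = (p : Ket d) := by
  have horth : Orthonormal ℂ (({i} : Set (Fin d)).domRestrict fun _ => (p : Ket d)) := by
    rw [orthonormal_iff_ite]
    rintro ⟨j, rfl⟩ ⟨k, rfl⟩
    simp [inner_self_eq_norm_sq_to_K]
  obtain ⟨b, hb⟩ := horth.exists_orthonormalBasis_extension_of_card_eq
    (by simp : Module.finrank ℂ (Ket d) = Fintype.card (Fin d))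
  refine ⟨⟨(EuclideanSpace.basisFun (Fin d) ℂ).toBasis.toMatrix b,
    (EuclideanSpace.basisFun (Fin d) ℂ).toMatrix_orthonormalBasis_mem_unitary b⟩, ?_⟩
  rw [Matrix.mulVec_single_one]
  ext k
  simp [Module.Basis.toMatrix_apply, hb i rfl]

/-- A unitary that prepares the state `p` from the basis state `i`. -/
def prepUnitary (i : Fin d) (p : PureState d) : UU d := (exists_unitary_mulVec_single i p).choose

lemma prepUnitary_mulVec_single (i : Fin d) (p : PureState d) :
    (prepUnitary i p : Matrix (Fin d) (Fin d) ℂ).mulVec (Pi.single i 1) = (p : Ket d) :=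
  (exists_unitary_mulVec_single i p).choose_spec

variable [NeZero d]

/-- The protocol that performs one trial on the image of each of the states `p 0, p 1, …` under the
unknown unitary, with the register initially in the basis state `i` and the bases of the trials
selected by `s`, and that computes its output from the outcomes by `dec`. -/
def trialsProtocol : {T : ℕ} → (Fin T → PureState d) → (Fin T → TrialSeed d) → Fin d →
    ((Fin T → Fin d) → UU d) → Protocol d
  | 0, _, _, _, dec => .output (dec Fin.elim0)
  | _ + 1, p, s, i, dec =>
    .applyUnitary (prepUnitary i (p 0)) <| .query <| .applyUnitary (measUnitary (s 0)) <|
      .measure fun k => trialsProtocol (Fin.tail p) (Fin.tail s) k fun o => dec (Fin.cons k o)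

lemma queries_trialsProtocol_le {T : ℕ} (p : Fin T → PureState d) (s : Fin T → TrialSeed d)
    (i : Fin d) (dec : (Fin T → Fin d) → UU d) : (trialsProtocol p s i dec).queries ≤ T := by
  induction T generalizing i with
  | zero => simp [trialsProtocol, Protocol.queries]
  | succ T ih =>
    simp only [trialsProtocol, Protocol.queries]
    exact Nat.succ_le_succ (Finset.sup_le fun k _ => ih _ _ _ _)

lemma law_trialsProtocol (Z : UU d) {T : ℕ} (p : Fin T → PureState d) (s : Fin T → TrialSeed d)
    (i : Fin d) (dec : (Fin T → Fin d) → UU d) :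
    (trialsProtocol p s i dec).law Z (Pi.single i 1) = ∑ o : Fin T → Fin d,
      (∏ t, ENNReal.ofReal (‖unitaryOp (measUnitary (s t)) (evolve Z (p t)) (o t)‖ ^ 2)) •
        Measure.dirac (dec o) := by
  induction T generalizing i with
  | zero => simp [trialsProtocol, Protocol.law, Subsingleton.elim _ Fin.elim0]
  | succ T ih =>
    simp only [trialsProtocol, Protocol.law, ih, prepUnitary_mulVec_single, Finset.smul_sum,
      smul_smul]
    rw [← (Fin.consEquiv fun _ : Fin (T + 1) => Fin d).sum_comp, Fintype.sum_prod_type]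
    refine Finset.sum_congr rfl fun k _ => Finset.sum_congr rfl fun o _ => ?_
    rw [Fin.prod_univ_succ]
    rfl

/-- The algorithm that draws the bases of all trials uniformly and independently and then runs
`trialsProtocol`, with an output that depends on the bases and on the outcomes. -/
def trialsAlgorithm {T : ℕ} (p : Fin T → PureState d)
    (dec : (Fin T → TrialSeed d × Fin d) → UU d) : TomographyAlgorithm d where
  Seed := Fin T → TrialSeed d
  seedLaw := (PMF.uniformOfFintype (Fin T → TrialSeed d)).toMeasure
  protocol s := trialsProtocol p s 0 fun o => dec fun t => (s t, o t)
  measurable_law _ := .of_discrete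

lemma queriesAtMost_trialsAlgorithm {T : ℕ} (p : Fin T → PureState d)
    (dec : (Fin T → TrialSeed d × Fin d) → UU d) : (trialsAlgorithm p dec).QueriesAtMost T :=
  fun _ => Nat.cast_le.2 (queries_trialsProtocol_le _ _ _ _)

lemma uniform_seed_mul_prod_eq {T : ℕ} (v : Fin T → PureState d) (s : Fin T → TrialSeed d)
    (o : Fin T → Fin d) :
    (Fintype.card (Fin T → TrialSeed d) : ENNReal)⁻¹ *
        ∏ t, ENNReal.ofReal (‖unitaryOp (measUnitary (s t)) (v t) (o t)‖ ^ 2) =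
      (Measure.pi fun t => trialLaw (v t)) {fun t => (s t, o t)} := by
  rw [Measure.pi_singleton]
  simp only [trialLaw_singleton, trialProb]
  simp only [ENNReal.ofReal_mul (show (0 : ℝ) ≤ (2 * 4 ^ d)⁻¹ by positivity),
    Finset.prod_mul_distrib, Finset.prod_const, Finset.card_univ, Fintype.card_fin]
  congr 1
  rw [ENNReal.ofReal_inv_of_pos (by positivity), ← ENNReal.inv_pow]
  congr 1
  simp [ENNReal.ofReal_mul, ENNReal.ofReal_pow]

lemma outputLaw_trialsAlgorithm (Z : UU d) {T : ℕ} (p : Fin T → PureState d)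
    (dec : (Fin T → TrialSeed d × Fin d) → UU d) :
    (trialsAlgorithm p dec).outputLaw Z =
      (Measure.pi fun t => trialLaw (evolve Z (p t))).map dec := by
  ext S hS
  rw [TomographyAlgorithm.outputLaw,
    Measure.bind_apply hS ((trialsAlgorithm p dec).measurable_law Z).aemeasurable]
  change ∫⁻ s : Fin T → TrialSeed d,
    (trialsProtocol p s 0 fun o => dec fun t => (s t, o t)).law Z (Pi.single 0 1) S
      ∂(PMF.uniformOfFintype _).toMeasure = _
  rw [lintegral_fintype, ← lintegral_indicator_one hS,
    lintegral_map (measurable_one.indicator hS) .of_discrete, lintegral_fintype,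
    ← (Equiv.arrowProdEquivProdArrow (Fin T) (fun _ => TrialSeed d) fun _ => Fin d).symm.sum_comp,
    Fintype.sum_prod_type]
  refine Finset.sum_congr rfl fun s _ => ?_
  rw [PMF.toMeasure_apply_singleton _ _ (measurableSet_singleton s), PMF.uniformOfFintype_apply]
  simp only [law_trialsProtocol, Measure.coe_finsetSum, Finset.sum_apply,
    Measure.smul_apply, smul_eq_mul, Finset.sum_mul, Measure.dirac_apply' _ hS]
  refine Finset.sum_congr rfl fun o _ => ?_
  rw [mul_right_comm, mul_comm (∏ t, _), uniform_seed_mul_prod_eq, mul_comm]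
  rfl

end TrialsAlgorithm

section Tomography

variable {d : ℕ} [NeZero d]

/-- The tomography algorithm: `d * n` trials on the image of the basis state `0`, then `n` trials
on the image of each probe state. -/
def tomographyAlgorithm (d : ℕ) [NeZero d] (n : ℕ) : TomographyAlgorithm d :=
  let e := (Fintype.equivFin ((Fin d × Fin n) ⊕ (Fin d × Fin n))).symm
  trialsAlgorithm (Sum.elim (fun _ => probe 0) (fun i => probe i.1) ∘ e) fun ω =>
    decode (fun i => ω (e.symm (.inl i))) fun i => ω (e.symm (.inr i))

lemma queriesAtMost_tomographyAlgorithm (n : ℕ) :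
    (tomographyAlgorithm d n).QueriesAtMost (2 * (d * n)) := by
  intro s
  refine (queriesAtMost_trialsAlgorithm _ _ s).trans_eq ?_
  simp [two_mul]

lemma outputLaw_tomographyAlgorithm (Z : UU d) (n : ℕ) :
    (tomographyAlgorithm d n).outputLaw Z =
      ((Measure.pi fun _ : Fin d × Fin n => trialLaw (evolve Z (probe 0))).prod
        (Measure.pi fun i : Fin d × Fin n => trialLaw (evolve Z (probe i.1)))).map
        fun ω => decode ω.1 ω.2 := by
  let p : (Fin d × Fin n) ⊕ (Fin d × Fin n) → PureState d :=
    Sum.elim (fun _ => probe 0) fun i => probe i.1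
  have hsplit := map_pi_comp_sum_equiv (fun i => trialLaw (evolve Z (p i)))
    (Fintype.equivFin ((Fin d × Fin n) ⊕ (Fin d × Fin n))).symm
  refine (outputLaw_trialsAlgorithm Z _ _).trans (Eq.trans ?_ (congrArg (Measure.map _) hsplit))
  rw [Measure.map_map .of_discrete .of_discrete]
  rfl

end Tomography

section Parameters

variable {d : ℕ}

lemma outputLaw_tomographyAlgorithm_le_add [NeZero d] (Z : UU d) (n : ℕ) [NeZero n] {δ τ : ℝ}
    (hδ0 : 0 ≤ δ) (hδ : δ ≤ 1) (hτ0 : 0 ≤ τ) (hτ : τ ≤ 1) :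
    (tomographyAlgorithm d n).outputLaw Z {V | ¬ phaseDist Z V ≤ 2 * (τ + 4 * δ * √d)} ≤
      ENNReal.ofReal (625 ^ d * Real.exp (-((d * n : ℕ) * (δ / 2304) ^ 2))) +
        ENNReal.ofReal (625 ^ d * Real.exp (-(n * (τ / 2304) ^ 2))) := by
  let μ₁ := Measure.pi fun _ : Fin d × Fin n => trialLaw (evolve Z (probe 0))
  let μ₂ := Measure.pi fun i : Fin d × Fin n => trialLaw (evolve Z (probe i.1))
  let B := {ω₁ : Fin d × Fin n → TrialSeed d × Fin d | δ < ‖meanOp ω₁ -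
    InnerProductSpace.rankOne ℂ (evolve Z (probe 0) : Ket d) (evolve Z (probe 0) : Ket d)‖}
  rw [outputLaw_tomographyAlgorithm, ← Set.compl_ofPred,
    Measure.map_apply .of_discrete (measurableSet_phaseDist_le Z _).compl]
  refine (measure_prod_le_add μ₁ μ₂ .of_discrete (B := B) .of_discrete
    (b := ENNReal.ofReal (625 ^ d * Real.exp (-(n * (τ / 2304) ^ 2)))) fun ω₁ hω₁ => ?_).trans ?_
  · let r := nearestState (meanOp ω₁)
    calc μ₂ {ω₂ | ¬ phaseDist Z (decode ω₁ ω₂) ≤ 2 * (τ + 4 * δ * √d)}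
        ≤ μ₂ {ω₂ | τ < ‖estimateOp (r : Ket d) ω₂ - idealOp Z r‖} :=
          measure_mono fun ω₂ hω₂ => not_le.1 fun h =>
            hω₂ (phaseDist_decode_le Z ω₁ ω₂ (not_lt.1 hω₁) h)
      _ ≤ _ := by
          rw [← ofReal_measureReal]
          simpa using ENNReal.ofReal_le_ofReal
            (measureReal_lt_norm_estimateOp_sub_le (κ := Fin n) Z r hτ0 hτ)
  · gcongr
    rw [← ofReal_measureReal]
    simpa using ENNReal.ofReal_le_ofReal
      (measureReal_lt_norm_meanOp_sub_le (ι := Fin d × Fin n) (evolve Z (probe 0)) hδ0 hδ)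

lemma outputLaw_tomographyAlgorithm_le [NeZero d] (Z : UU d) (n : ℕ) [NeZero n] {ε : ℝ}
    (hε : 0 ≤ ε) (hε4 : ε ≤ 4) :
    (tomographyAlgorithm d n).outputLaw Z {V | ¬ phaseDist Z V ≤ ε} ≤
      ENNReal.ofReal (2 * (625 ^ d * Real.exp (-(n * (ε / 36864) ^ 2)))) := by
  have hd : (1 : ℝ) ≤ d := mod_cast NeZero.one_le
  have hsqrt : 1 ≤ √(d : ℝ) := Real.one_le_sqrt.2 hd
  have h := outputLaw_tomographyAlgorithm_le_add Z n (δ := ε / (16 * √d)) (τ := ε / 4)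
    (by positivity) (by rw [div_le_one (by positivity)]; linarith) (by positivity) (by linarith)
  have herr : 2 * (ε / 4 + 4 * (ε / (16 * √d)) * √d) = ε := by
    field_simp
    ring
  have hexp₁ : (d * n : ℕ) * (ε / (16 * √d) / 2304) ^ 2 = n * (ε / 36864) ^ 2 := by
    push_cast
    field_simp
    rw [Real.sq_sqrt (by positivity)]
    ring
  have hexp₂ : n * (ε / 36864) ^ 2 ≤ n * (ε / 4 / 2304) ^ 2 := by
    gcongr ?_ * ?_ ^ 2
    linarith
  rw [herr, hexp₁] at h
  refine h.trans ?_
  rw [two_mul, ENNReal.ofReal_add (by positivity) (by positivity)]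
  gcongr

lemma log_two_le_log_max (x : ℝ) : Real.log 2 ≤ Real.log (max 2 x) :=
  Real.log_le_log two_pos (le_max_left _ _)

lemma two_mul_pow_mul_exp_le (hd : 1 ≤ d) {η : ℝ} (hη : 0 < η) :
    2 * (625 ^ d * Real.exp (-(12 * d * Real.log (max 2 (1 / η))))) ≤ η := by
  set L := Real.log (max 2 (1 / η))
  have hd' : (1 : ℝ) ≤ d := mod_cast hd
  have hexpL : Real.exp L = max 2 (1 / η) := Real.exp_log (two_pos.trans_le (le_max_left _ _))
  have h2 : 2 ≤ Real.exp L := hexpL ▸ le_max_left _ _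
  have hL : 0 ≤ L := (Real.log_pos one_lt_two).le.trans (log_two_le_log_max _)
  have h625 : (625 : ℝ) ^ d ≤ Real.exp (10 * d * L) := by
    rw [show 10 * d * L = d * (10 * L) by ring, Real.exp_nat_mul]
    gcongr
    rw [show 10 * L = (10 : ℕ) * L by norm_num, Real.exp_nat_mul]
    exact (by norm_num : (625 : ℝ) ≤ 2 ^ 10).trans (by gcongr)
  calc 2 * (625 ^ d * Real.exp (-(12 * d * L)))
      ≤ Real.exp L * (Real.exp (10 * d * L) * Real.exp (-(12 * d * L))) := by gcongr
    _ = Real.exp (L - 2 * d * L) := by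
        rw [← Real.exp_add, ← Real.exp_add]
        ring_nf
    _ ≤ Real.exp (-L) := by
        gcongr
        nlinarith
    _ ≤ η := by
        rw [Real.exp_neg, hexpL]
        exact inv_le_of_inv_le₀ hη (one_div η ▸ le_max_right _ _)

/-- The number of trials per probe state for accuracy `ε` and failure probability `η`. No trial is
needed when `2 ≤ ε`, since `phaseDist` is at most `2`. -/
def numTrials (d : ℕ) (ε η : ℝ) : ℕ :=
  if ε < 2 then ⌈12 * d * Real.log (max 2 (1 / η)) * (36864 / ε) ^ 2⌉₊ else 0

lemma numTrials_le (hd : 1 ≤ d) {ε : ℝ} (hε : 0 < ε) (η : ℝ) :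
    numTrials d ε η ≤ 24 * d * Real.log (max 2 (1 / η)) * (36864 / ε) ^ 2 := by
  have hd' : (1 : ℝ) ≤ d := mod_cast hd
  have hL : 1 / 2 ≤ Real.log (max 2 (1 / η)) :=
    (by linarith [Real.log_two_gt_d9] : 1 / 2 ≤ Real.log 2).trans (log_two_le_log_max _)
  unfold numTrials
  split_ifs with hε2
  · have hratio : 1 ≤ 36864 / ε := (one_le_div hε).2 (by linarith)
    refine (Nat.ceil_le_two_mul ?_).trans_eq (by ring)
    calc (2 : ℝ)⁻¹ ≤ 12 * 1 * (1 / 2) * 1 ^ 2 := by norm_num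
      _ ≤ _ := by gcongr
  · simp only [Nat.cast_zero]
    positivity

lemma outputLaw_tomographyAlgorithm_numTrials_le [NeZero d] (Z : UU d) {ε η : ℝ} (hε : 0 < ε)
    (hη : 0 < η) :
    (tomographyAlgorithm d (numTrials d ε η)).outputLaw Z {V | ¬ phaseDist Z V ≤ ε} ≤
      ENNReal.ofReal η := by
  obtain hε2 | hε2 := le_or_gt 2 ε
  · simp [(phaseDist_le_two Z _).trans hε2]
  have hn : 12 * d * Real.log (max 2 (1 / η)) ≤ numTrials d ε η * (ε / 36864) ^ 2 := by
    rw [numTrials, if_pos hε2, ← inv_div _ ε, inv_pow, ← div_eq_mul_inv,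
      le_div_iff₀ (by positivity)]
    exact Nat.le_ceil _
  have hpos : 0 < 12 * d * Real.log (max 2 (1 / η)) := by
    have := (Real.log_pos one_lt_two).trans_le (log_two_le_log_max (1 / η))
    have := NeZero.pos d
    positivity
  have : NeZero (numTrials d ε η) := ⟨fun h =>
    hpos.not_ge (by simpa only [h, Nat.cast_zero, zero_mul] using hn)⟩
  refine (outputLaw_tomographyAlgorithm_le Z _ hε.le (by linarith)).trans
    (ENNReal.ofReal_le_ofReal (le_trans ?_ (two_mul_pow_mul_exp_le (NeZero.one_le (n := d)) hη)))
  gcongr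

lemma queriesAtMost_tomographyAlgorithm_numTrials [NeZero d] {ε : ℝ} (hε : 0 < ε) (η : ℝ) :
    (tomographyAlgorithm d (numTrials d ε η)).QueriesAtMost
      (48 * 36864 ^ 2 * ((d : ℝ) ^ 2 / ε ^ 2) * Real.log (max 2 (1 / η))) := by
  intro s
  calc _ ≤ 2 * (d * (numTrials d ε η : ℝ)) := queriesAtMost_tomographyAlgorithm _ s
    _ ≤ 2 * (d * (24 * d * Real.log (max 2 (1 / η)) * (36864 / ε) ^ 2)) := by
        gcongr
        exact numTrials_le NeZero.one_le hε η
    _ = _ := by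
        rw [div_pow]
        ring

end Parameters

end UnitaryTomography

end

theorem theorem3 :
    ∃ C : ℝ, 0 < C ∧
      ∃ alg : (d : ℕ) → [NeZero d] → (ε η : ℝ) → UnitaryTomography.TomographyAlgorithm d,
        ∀ (d : ℕ) [NeZero d] (ε η : ℝ), 0 < ε → 0 < η →
          (alg d ε η).QueriesAtMost
            (C * ((d : ℝ) ^ 2 / ε ^ 2) * Real.log (max 2 (1 / η))) ∧
          ∀ Z : UnitaryTomography.UU d,
            (alg d ε η).outputLaw Z {V | ¬ UnitaryTomography.phaseDist Z V ≤ ε} ≤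
              ENNReal.ofReal η := by
  refine ⟨48 * 36864 ^ 2, by norm_num, fun d _ ε η =>
    UnitaryTomography.tomographyAlgorithm d (UnitaryTomography.numTrials d ε η),
    fun d _ ε η hε hη => ⟨?_, fun Z => ?_⟩⟩
  · exact UnitaryTomography.queriesAtMost_tomographyAlgorithm_numTrials hε η
  · exact UnitaryTomography.outputLaw_tomographyAlgorithm_numTrials_le Z hε hη
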